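/- Let $\mathbb{M}_2=\mathbb{F}_2[\tau]$, bigraded (topological degree, weight) with $\tau$ in bidegree $(0,1)$. Let $\mathsf{A}$ be the mod 2 motivic Steenrod algebra over $\mathbb{C}$: the bigraded $\mathbb{M}_2$-algebra generated by elements $\mathrm{Sq}^n$ ($n\ge 0$) of bidegree $(n,\lfloor n/2\rfloor)$, subject to $\mathrm{Sq}^0=1$ and to the motivic Adem relations $$\mathrm{Sq}^a\mathrm{Sq}^b=\sum_{j=0}^{\lfloor a/2\rfloor}\binom{b-1-j}{a-2j}\,\tau^{\varepsilon}\,\mathrm{Sq}^{a+b-j}\mathrm{Sq}^j\qquad(0<a<2b),$$ where $\varepsilon=1$ if $a,b$ are even and $j$ is odd, and $\varepsilon=0$ otherwise. Let $\mathsf{A}(1)\subset\mathsf{A}$ be the $\mathbb{M}_2$-subalgebra generated by $\mathrm{Sq}^1$ and $\mathrm{Sq}^2$, and regard $\mathbb{M}_2$ as a bigraded left $\mathsf{A}(1)$-module through the augmentation $\mathrm{Sq}^n\mapsto 0$ ($n>0$). For bigraded $\mathsf{A}(1)$-modules let $\Sigma^{a,b}$ denote the shift that raises bidegrees by $(a,b)$.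 An element of $\mathrm{Ext}^{n}_{\mathsf{A}(1)}(\mathbb{M}_2,\Sigma^{a,b}\mathbb{M}_2)$, where $\mathrm{Ext}$ is taken in the abelian category of bigraded left $\mathsf{A}(1)$-modules and degree-preserving $\mathsf{A}(1)$-linear maps, is said to have internal bidegree $(a,b)$ and Adams tridegree $(a-n,n,b)$. Let $$\mathrm{Ext}_{\mathsf{A}(1)}(\mathbb{M}_2,\mathbb{M}_2)=\bigoplus_{n\ge 0,\ (a,b)\in\mathbb{Z}^2}\mathrm{Ext}^{n}_{\mathsf{A}(1)}(\mathbb{M}_2,\Sigma^{a,b}\mathbb{M}_2),$$ with the Yoneda product, and with the map from $\mathbb{M}_2$ that sends a homogeneous $p$ of bidegree $(-a,-b)$ to the class in $\mathrm{Ext}^0$ of multiplication by $p$, $\mathbb{M}_2\to\Sigma^{a,b}\mathbb{M}_2$. Then there are classes $h_0,h_1,\alpha,\beta$ in $\mathrm{Ext}_{\mathsf{A}(1)}(\mathbb{M}_2,\mathbb{M}_2)$, of Adams tridegrees $(0,1,0)$, $(1,1,1)$, $(4,3,2)$, $(8,4,4)$ respectively, that induce an isomorphism of $\mathbb{M}_2$-algebras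 $$\mathbb{M}_2[h_0,h_1,\alpha,\beta]\big/\bigl(h_0h_1,\ \tau h_1^3,\ h_1\alpha,\ \alpha^2-h_0^2\beta\bigr)\;\cong\;\mathrm{Ext}_{\mathsf{A}(1)}(\mathbb{M}_2,\mathbb{M}_2).$$ -/

import Mathlib

open CategoryTheory CategoryTheory.Limits CategoryTheory.Abelian

noncomputable section

namespace MotivicExt

/-! ### The category of bigraded modules over a graded ring -/

section GradedModules

variable {ι A : Type} [AddCommGroup ι] [Ring A] (𝒜 : ι → AddSubgroup A)
  [SetLike.GradedMonoid 𝒜]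

/-- The preadditive category of degrees of a graded ring `(A, 𝒜)`: its objects are the degrees,
the morphisms from `i` to `j` are the elements of `A` of degree `j - i`, and the composite of
`a : i ⟶ j` and `b : j ⟶ k` is the product `b * a`. -/
structure DegreeCat (𝒜 : ι → AddSubgroup A) : Type where
  /-- the underlying degree -/
  deg : ι

instance : Category (DegreeCat 𝒜) where
  Hom i j := 𝒜 (j.deg - i.deg)
  id i := ⟨1, by rw [sub_self]; exact SetLike.GradedOne.one_mem⟩
  comp {i j k} a b := ⟨b.1 * a.1, by
    rw [← sub_add_sub_cancel k.deg j.deg i.deg]; exact SetLike.GradedMul.mul_mem b.2 a.2⟩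
  id_comp a := Subtype.ext (mul_one _)
  comp_id a := Subtype.ext (one_mul _)
  assoc a b c := Subtype.ext (mul_assoc _ _ _).symm

instance (i j : DegreeCat 𝒜) : AddCommGroup (i ⟶ j) :=
  inferInstanceAs (AddCommGroup (𝒜 (j.deg - i.deg)))

instance : Preadditive (DegreeCat 𝒜) where
  add_comp _ _ _ _ _ _ := Subtype.ext (mul_add _ _ _)
  comp_add _ _ _ _ _ _ := Subtype.ext (add_mul _ _ _)

/-- An element of `A` of degree `j - i`, as a morphism of degrees `i ⟶ j`. -/
def homOfMem {i j : DegreeCat 𝒜} (a : A) (h : a ∈ 𝒜 (j.deg - i.deg)) : i ⟶ j := ⟨a, h⟩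

/-- Between equal degrees there is the morphism given by `1 : A`. -/
def homOfEq {i j : DegreeCat 𝒜} (h : i.deg = j.deg) : i ⟶ j :=
  homOfMem 𝒜 1 (by rw [h, sub_self]; exact SetLike.GradedOne.one_mem)

/-- A functor to abelian groups is a graded left `A`-module if it is additive: it consists of
abelian groups `M i` (the components), one for each degree `i`, and of biadditive multiplications
`𝒜 d × M i → M (d + i)` that satisfy `1 m = m` and `(b a) m = b (a m)`. -/
def isGradedModule : ObjectProperty (DegreeCat 𝒜 ⥤ AddCommGrpCat.{0}) := fun F => F.Additive

/-- The category of graded left modules over the graded ring `(A, 𝒜)`, with the degree-preserving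
`A`-linear maps (the natural transformations). -/
abbrev GradedMod : Type 1 := (isGradedModule 𝒜).FullSubcategory

instance (M : GradedMod 𝒜) : M.obj.Additive := M.property

instance : (isGradedModule 𝒜).IsClosedUnderSubobjects where
  prop_of_mono {X Y} f _ (hY : Y.Additive) := by
    refine (⟨fun {i j a b} => ?_⟩ : X.Additive)
    rw [← cancel_mono (f.app j)]
    simp [Functor.map_add]

instance : (isGradedModule 𝒜).IsClosedUnderQuotients where
  prop_of_epi {X Y} f _ (hX : X.Additive) := by
    refine (⟨fun {i j a b} => ?_⟩ : Y.Additive)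
    rw [← cancel_epi (f.app i), ← f.naturality, Functor.map_add, Preadditive.add_comp,
      Preadditive.comp_add, f.naturality, f.naturality]

instance : (isGradedModule 𝒜).ContainsZero where
  exists_zero := by
    obtain ⟨Z, hZ⟩ := HasZeroObject.zero (C := DegreeCat 𝒜 ⥤ AddCommGrpCat.{0})
    exact ⟨Z, hZ, ⟨fun {_ j _ _} => ((Functor.isZero_iff _).1 hZ j).eq_of_tgt _ _⟩⟩

instance : (isGradedModule 𝒜).IsClosedUnderFiniteProducts where
  isClosedUnderLimitsOfShape J _ :=
    { limitsOfShape_le := by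
        rintro X ⟨p⟩
        refine (⟨fun {i j a b} => ?_⟩ : X.Additive)
        refine (isLimitOfPreserves ((evaluation _ _).obj j) p.isLimit).hom_ext fun k => ?_
        have : (p.diag.obj k).Additive := p.prop_diag_obj k
        have e (c : i ⟶ j) : X.map c ≫ (p.π.app k).app j =
          (p.π.app k).app i ≫ (p.diag.obj k).map c := (p.π.app k).naturality c
        change X.map (a + b) ≫ (p.π.app k).app j = (X.map a + X.map b) ≫ (p.π.app k).app j
        rw [Preadditive.add_comp, e, e, e, Functor.map_add, Preadditive.comp_add] }

instance : HasExt.{1} (GradedMod 𝒜) := HasExt.standard _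

/-- Translation of degrees by `-d`. -/
def translate (d : ι) : DegreeCat 𝒜 ⥤ DegreeCat 𝒜 where
  obj i := ⟨i.deg - d⟩
  map {i j} a := homOfMem 𝒜 a.1 (by
    change a.1 ∈ 𝒜 (j.deg - d - (i.deg - d)); rw [sub_sub_sub_cancel_right]; exact a.2)

instance (d : ι) : (translate 𝒜 d).Additive where

/-- The suspension `Σ^d M` of a graded module, which raises all degrees by `d`:
`(Σ^d M) i = M (i - d)`, with the same multiplication. -/
def susp (d : ι) : GradedMod 𝒜 ⥤ GradedMod 𝒜 :=
  (isGradedModule 𝒜).lift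
    ((isGradedModule 𝒜).ι ⋙ (Functor.whiskeringLeft _ _ _).obj (translate 𝒜 d))
    (fun M => (inferInstance : (translate 𝒜 d ⋙ M.obj).Additive))

instance (d : ι) : (susp 𝒜 d).Additive where

instance : (isGradedModule 𝒜).ι.PreservesMonomorphisms :=
  (isGradedModule 𝒜).preservesMonomorphisms_ι_of_isNormalEpiCategory

instance : (isGradedModule 𝒜).ι.PreservesEpimorphisms :=
  (isGradedModule 𝒜).preservesEpimorphisms_ι_of_isNormalMonoCategory

instance : PreservesFiniteLimits (isGradedModule 𝒜).ι :=
  have := fun X Y (f : X ⟶ Y) => (isGradedModule 𝒜).preservesKernels_ι f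
  Functor.preservesFiniteLimits_of_preservesKernels _

instance : PreservesFiniteColimits (isGradedModule 𝒜).ι :=
  have := fun X Y (f : X ⟶ Y) => (isGradedModule 𝒜).preservesCokernels_ι f
  Functor.preservesFiniteColimits_of_preservesCokernels _

instance (d : ι) : PreservesFiniteLimits (susp 𝒜 d) :=
  have : PreservesFiniteLimits (susp 𝒜 d ⋙ (isGradedModule 𝒜).ι) :=
    inferInstanceAs (PreservesFiniteLimits
      ((isGradedModule 𝒜).ι ⋙ (Functor.whiskeringLeft _ _ _).obj (translate 𝒜 d)))
  preservesFiniteLimits_of_reflects_of_preserves _ (isGradedModule 𝒜).ι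

instance (d : ι) : PreservesFiniteColimits (susp 𝒜 d) :=
  have : PreservesFiniteColimits (susp 𝒜 d ⋙ (isGradedModule 𝒜).ι) :=
    inferInstanceAs (PreservesFiniteColimits
      ((isGradedModule 𝒜).ι ⋙ (Functor.whiskeringLeft _ _ _).obj (translate 𝒜 d)))
  preservesFiniteColimits_of_reflects_of_preserves _ (isGradedModule 𝒜).ι

/-- The canonical isomorphism `Σ^d Σ^e M ≅ Σ^(d + e) M`, the identity on elements. -/
def suspSusp (M : GradedMod 𝒜) (d e : ι) :
    (susp 𝒜 d).obj ((susp 𝒜 e).obj M) ⟶ (susp 𝒜 (d + e)).obj M :=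
  ObjectProperty.homMk
    { app := fun i => M.obj.map (homOfEq 𝒜 (sub_sub i.deg d e))
      naturality := fun i j a => by
        change M.obj.map _ ≫ M.obj.map _ = M.obj.map _ ≫ M.obj.map _
        rw [← M.obj.map_comp, ← M.obj.map_comp]
        congr 1
        exact Subtype.ext ((one_mul a.1).trans (mul_one a.1).symm) }

/-- The group of classes of internal degree `d` in `Ext^n(M, N)`, namely the group
`Ext^n(M, Σ^d N)` in the abelian category of graded modules. -/
abbrev GExt (M N : GradedMod 𝒜) (p : ℕ × ι) : Type 1 :=
  Ext.{1} M ((susp 𝒜 p.2).obj N) p.1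

/-- The Yoneda product of `x ∈ Ext^n(M, Σ^d M)` and `y ∈ Ext^m(M, Σ^e M)`: the composite of `x`
with `Σ^d y`, in `Ext^(n + m)(M, Σ^(d + e) M)`. -/
def yonedaMul (M : GradedMod 𝒜) {p q : ℕ × ι} (x : GExt 𝒜 M M p) (y : GExt 𝒜 M M q) :
    GExt 𝒜 M M (p + q) :=
  (x.comp (y.mapExactFunctor (susp 𝒜 p.2)) rfl).comp
    (Ext.mk₀ (suspSusp 𝒜 M p.2 q.2)) (add_zero _)

/-- The Yoneda product is biadditive, so that it extends to a product on the direct sum of all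
`Ext^n(M, Σ^d M)`. (Only biadditivity is recorded here. Associativity and the unit are not assumed
anywhere; they follow for any direct sum that is isomorphic, through an additive and multiplicative
bijection, to a ring.) -/
instance (M : GradedMod 𝒜) : DirectSum.GNonUnitalNonAssocSemiring (GExt 𝒜 M M) where
  mul x y := yonedaMul 𝒜 M x y
  mul_zero x := by simp [yonedaMul]
  zero_mul y := by simp [yonedaMul]
  mul_add x y z := by simp [yonedaMul]
  add_mul x y z := by simp [yonedaMul]

/-- `Ext(M, M)`, the direct sum of the groups `Ext^n(M, Σ^d M)` over all `n` and `d`, with the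
Yoneda product. -/
abbrev ExtRing (M : GradedMod 𝒜) : Type 1 := DirectSum (ℕ × ι) (GExt 𝒜 M M)

end GradedModules

/-! ### The motivic Steenrod algebra and its subalgebra `A(1)` -/

/-- The coefficient ring `𝔽₂[τ]`. -/
abbrev M2 : Type := Polynomial (ZMod 2)

/-- The polynomial generator of `𝔽₂[τ]`. -/
def tau : M2 := Polynomial.X

/-- The bigrading of `𝔽₂[τ]` (topological degree, weight), in which `τ` has bidegree `(0, 1)`. -/
def gradM2 (d : ℤ × ℤ) : AddSubgroup M2 where
  carrier := {p | ∀ k : ℕ, p.coeff k ≠ 0 → ((0 : ℤ), (k : ℤ)) = d}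
  zero_mem' := fun k h => absurd (Polynomial.coeff_zero k) h
  add_mem' := fun {p q} hp hq k h => by
    by_cases h' : p.coeff k = 0
    · exact hq k fun h'' => h (by rw [Polynomial.coeff_add, h', h'', add_zero])
    · exact hp k h'
  neg_mem' := fun {p} hp k h => hp k fun h' => h (by rw [Polynomial.coeff_neg, h', neg_zero])

theorem tau_pow_mem (k : ℕ) : tau ^ k ∈ gradM2 (0, k) := fun j h => by
  rw [tau, Polynomial.coeff_X_pow] at h
  rw [show j = k by by_contra h'; exact h (if_neg h')]

instance : SetLike.GradedMonoid gradM2 where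
  one_mem := tau_pow_mem 0
  mul_mem := fun {d e p q} hp hq k h => by
    rw [Polynomial.coeff_mul] at h
    obtain ⟨⟨i, j⟩, hij, h'⟩ := Finset.exists_ne_zero_of_sum_ne_zero h
    replace hij : i + j = k := Finset.HasAntidiagonal.mem_antidiagonal.1 hij
    rw [← hp i (left_ne_zero_of_mul h'), ← hq j (right_ne_zero_of_mul h'), ← hij]
    simp

/-- The defining relations of the mod 2 motivic Steenrod algebra over `ℂ` in the generators
`Sq^n`, `n ≥ 0`: the relation `Sq^0 = 1` and, for `0 < a < 2 b`, the motivic Adem relation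
`Sq^a Sq^b = ∑_j binom(b - 1 - j, a - 2 j) τ^{ε} Sq^{a + b - j} Sq^j`, summed over
`0 ≤ j ≤ a / 2`, where `ε = 1` if `a` and `b` are even and `j` is odd, and `ε = 0` otherwise. -/
inductive AdemRel : FreeAlgebra M2 ℕ → FreeAlgebra M2 ℕ → Prop
  | sq_zero : AdemRel (FreeAlgebra.ι M2 0) 1
  | adem (a b : ℕ) (ha : 0 < a) (hab : a < 2 * b) :
      AdemRel (FreeAlgebra.ι M2 a * FreeAlgebra.ι M2 b)
        (∑ j ∈ Finset.range (a / 2 + 1),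
          (((b - 1 - j).choose (a - 2 * j) : M2) *
              tau ^ (if Even a ∧ Even b ∧ Odd j then 1 else 0)) •
            (FreeAlgebra.ι M2 (a + b - j) * FreeAlgebra.ι M2 j))

/-- The mod 2 motivic Steenrod algebra over `ℂ`, as an algebra over `𝔽₂[τ]`. -/
def Steenrod : Type := RingQuot AdemRel

instance : Semiring Steenrod := inferInstanceAs (Semiring (RingQuot AdemRel))

instance : Algebra M2 Steenrod := inferInstanceAs (Algebra M2 (RingQuot AdemRel))

instance : Ring Steenrod := Algebra.semiringToRing M2

/-- The motivic Steenrod square `Sq^n`, of bidegree `(n, ⌊n / 2⌋)`. -/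
def Sq (n : ℕ) : Steenrod := RingQuot.mkAlgHom M2 AdemRel (FreeAlgebra.ι M2 n)

/-- The bigrading of the motivic Steenrod algebra: the elements of bidegree `d` are the sums of
products `τ^k Sq^{i_1} ⋯ Sq^{i_r}` of total bidegree `d`. -/
def gradSteenrod (d : ℤ × ℤ) : AddSubgroup Steenrod :=
  AddSubgroup.closure {x | ∃ (k : ℕ) (l : List ℕ),
    (((l.sum : ℕ) : ℤ), ((k + (l.map (· / 2)).sum : ℕ) : ℤ)) = d ∧
      x = tau ^ k • (l.map Sq).prod}

instance : SetLike.GradedMonoid gradSteenrod where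
  one_mem := AddSubgroup.subset_closure ⟨0, [], by simp, by simp⟩
  mul_mem := fun {d e x y} hx hy => by
    induction hx using AddSubgroup.closure_induction with
    | mem x hx =>
      induction hy using AddSubgroup.closure_induction with
      | mem y hy =>
        obtain ⟨k, l, hd, rfl⟩ := hx
        obtain ⟨k', l', he, rfl⟩ := hy
        refine AddSubgroup.subset_closure ⟨k + k', l ++ l', ?_, ?_⟩
        · rw [← hd, ← he]
          ext
          · simp
          · simp only [List.map_append, List.sum_append, Nat.cast_add, Prod.snd_add]
            ring
        · rw [smul_mul_smul_comm, ← pow_add, List.map_append, List.prod_append]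
      | zero => rw [mul_zero]; exact zero_mem _
      | add y z _ _ h h' => rw [mul_add]; exact add_mem h h'
      | neg y _ h => rw [mul_neg]; exact neg_mem h
    | zero => rw [zero_mul]; exact zero_mem _
    | add y z _ _ h h' => rw [add_mul]; exact add_mem h h'
    | neg y _ h => rw [neg_mul]; exact neg_mem h

/-- The augmentation of the motivic Steenrod algebra, the `𝔽₂[τ]`-algebra map to `𝔽₂[τ]` that
sends `Sq^n` to `0` for `n > 0`. -/
def augmentation : Steenrod →ₐ[M2] M2 :=
  RingQuot.liftAlgHom M2 ⟨FreeAlgebra.lift M2 fun n => if n = 0 then 1 else 0, by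
    rintro _ _ (_ | ⟨a, b, ha, hab⟩)
    · simp
    · simp only [map_mul, map_sum, map_smul, FreeAlgebra.lift_ι_apply]
      rw [if_neg ha.ne', zero_mul]
      refine (Finset.sum_eq_zero fun j hj => ?_).symm
      rw [Finset.mem_range] at hj
      rw [if_neg (show ¬ a + b - j = 0 by omega), zero_mul, smul_zero]⟩

theorem augmentation_Sq (n : ℕ) : augmentation (Sq n) = if n = 0 then 1 else 0 :=
  (RingQuot.liftAlgHom_mkAlgHom_apply _ _ _ _).trans (FreeAlgebra.lift_ι_apply _ _)

theorem augmentation_mem {d : ℤ × ℤ} {x : Steenrod} (hx : x ∈ gradSteenrod d) :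
    augmentation x ∈ gradM2 d := by
  induction hx using AddSubgroup.closure_induction with
  | mem x hx =>
    obtain ⟨k, l, rfl, rfl⟩ := hx
    rw [map_smul, smul_eq_mul, map_list_prod, List.map_map]
    by_cases h : ∃ n ∈ l, n ≠ 0
    · obtain ⟨n, hn, h0⟩ := h
      rw [List.prod_eq_zero (List.mem_map.2 ⟨n, hn, by simp [augmentation_Sq, h0]⟩), mul_zero]
      exact zero_mem _
    · push Not at h
      obtain ⟨r, rfl⟩ : ∃ r, l = List.replicate r 0 := ⟨_, List.eq_replicate_iff.2 ⟨rfl, h⟩⟩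
      simpa [augmentation_Sq] using tau_pow_mem k
  | zero => rw [map_zero]; exact zero_mem _
  | add y z _ _ h h' => rw [map_add]; exact add_mem h h'
  | neg y _ h => rw [map_neg]; exact neg_mem h

/-- `A(1)`, the `𝔽₂[τ]`-subalgebra of the motivic Steenrod algebra generated by `Sq^1` and
`Sq^2`. -/
def A1 : Subalgebra M2 Steenrod := Algebra.adjoin M2 {Sq 1, Sq 2}

/-- The bigrading of `A(1)` induced by that of the motivic Steenrod algebra. -/
def gradA1 (d : ℤ × ℤ) : AddSubgroup A1 :=
  (gradSteenrod d).comap (A1.val : A1 →+ Steenrod)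

instance : SetLike.GradedMonoid gradA1 where
  one_mem := (SetLike.GradedOne.one_mem : (1 : Steenrod) ∈ gradSteenrod 0)
  mul_mem := fun {_ _ x y} hx hy =>
    (SetLike.GradedMul.mul_mem hx hy : (x : Steenrod) * y ∈ gradSteenrod _)

theorem smul_mem_gradM2 {d e f : ℤ × ℤ} {x : A1} (hx : x ∈ gradA1 d) {m : M2} (hm : m ∈ gradM2 e)
    (h : d + e = f) : augmentation x * m ∈ gradM2 f :=
  h ▸ SetLike.GradedMul.mul_mem (augmentation_mem hx) hm

/-- `𝔽₂[τ]` as a bigraded left module over `A(1)`, through the augmentation. -/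
def unitModule : GradedMod gradA1 where
  obj :=
    { obj := fun i => AddCommGrpCat.of (gradM2 i.deg)
      map := fun x => AddCommGrpCat.ofHom
        (AddMonoidHom.mk' (fun m => ⟨augmentation x.1.1 * m.1,
            smul_mem_gradM2 x.2 m.2 (sub_add_cancel _ _)⟩)
          fun _ _ => Subtype.ext (mul_add _ _ _))
      map_id := fun _ =>
        AddCommGrpCat.hom_ext (AddMonoidHom.ext fun m => Subtype.ext
          ((congrArg (· * m.1) (map_one augmentation)).trans (one_mul _)))
      map_comp := fun _ _ =>
        AddCommGrpCat.hom_ext (AddMonoidHom.ext fun m => Subtype.ext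
          ((congrArg (· * m.1) (map_mul augmentation _ _)).trans (mul_assoc _ _ _))) }
  property := ⟨
    AddCommGrpCat.hom_ext (AddMonoidHom.ext fun m => Subtype.ext
      ((congrArg (· * m.1) (map_add augmentation _ _)).trans (add_mul _ _ _)))⟩

/-- Multiplication by an element `p ∈ 𝔽₂[τ]` of bidegree `-d`, as a degree-preserving `A(1)`-linear
map from `𝔽₂[τ]` to `Σ^d 𝔽₂[τ]`. -/
def mulMap (d : ℤ × ℤ) (p : M2) (hp : p ∈ gradM2 (-d)) :
    unitModule ⟶ (susp gradA1 d).obj unitModule :=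
  ObjectProperty.homMk
    { app := fun i => AddCommGrpCat.ofHom
        (AddMonoidHom.mk' (fun m : gradM2 i.deg => (⟨p * m.1, by
            rw [sub_eq_neg_add]; exact SetLike.GradedMul.mul_mem hp m.2⟩ : gradM2 (i.deg - d)))
          fun m m' => Subtype.ext (mul_add _ _ _))
      naturality := fun i j x => by
        ext m
        exact Subtype.ext (mul_left_comm p (augmentation x.1.1) m.1) }

/-- The trigraded ring `Ext_{A(1)}(𝔽₂[τ], 𝔽₂[τ])`. -/
abbrev ExtA1 : Type 1 := ExtRing gradA1 unitModule

/-- The image in `Ext^0` of a homogeneous scalar `p ∈ 𝔽₂[τ]` of bidegree `-d`; these images define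
the `𝔽₂[τ]`-algebra structure of `Ext`. -/
def scalar (d : ℤ × ℤ) (p : M2) (hp : p ∈ gradM2 (-d)) : ExtA1 :=
  DirectSum.of (GExt gradA1 unitModule unitModule) (0, d) (Ext.mk₀ (mulMap d p hp))

/-- The classes of Adams tridegree `(s, n, w)`: the elements of `Ext^n` of internal bidegree
`(s + n, w)`. -/
def adamsPart (s : ℤ) (n : ℕ) (w : ℤ) : AddSubgroup ExtA1 :=
  (DirectSum.of (GExt gradA1 unitModule unitModule) (n, (s + n, w))).range

/-- The polynomial ring `𝔽₂[τ][h₀, h₁, α, β]`, with the variables numbered from `0` to `3`. -/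
abbrev GenRing : Type := MvPolynomial (Fin 4) M2

open MvPolynomial in
/-- The ideal generated by `h₀ h₁`, `τ h₁ ^ 3`, `h₁ α` and `α ^ 2 - h₀ ^ 2 β`. -/
def relIdeal : Ideal GenRing :=
  Ideal.span {X 0 * X 1, C tau * X 1 ^ 3, X 1 * X 2, X 2 ^ 2 - X 0 ^ 2 * X 3}

end MotivicExt

end

/-! The generators of `A(1)` satisfy three relations: Sq¹Sq¹ = 0, Sq²Sq² = τ Sq¹Sq²Sq¹ and
Sq²Sq¹Sq²Sq¹ = Sq¹Sq²Sq¹Sq². They rewrite every word as a combination of eight monomials. These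
monomials form a basis over 𝔽₂[τ]: a representation of the whole Steenrod algebra on 𝔽₂[τ]⁸
(`steenrodRep`) takes them to the unit vectors.

There is an explicit free resolution of 𝔽₂[τ] whose generators are the monomials of R = 𝔽₂[τ][x, y,
w]/(xy), with x, y dual to Sq¹, Sq² and w dual to the third relation. It is exact because of a
contracting homotopy that is linear over 𝔽₂[τ] (`contr_identity`). On maps to 𝔽₂[τ] only
coefficients of nonzero augmentation survive, and these turn the cochain complex into R with the
derivation d w = τ y³, d x = d y = 0 (`pairing_diffGen`). In characteristic 2 the cocycles are
spanned over 𝔽₂[τ] by w^{2k}, x^i w^k (i > 0) and y^j w^{2k}, and the coboundaries by τ y^{j+3}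
w^{2k}.

Put h₀ = x, h₁ = y, α = x w, β = w². Then h₀h₁ = 0, h₁α = 0 and α² = h₀²β hold already in R, while
τh₁³ is the coboundary of w. Conversely, modulo the relations every polynomial is a combination of
β^k, h₀^{i+1}β^k, h₀^iαβ^k and h₁^{j+1}β^k. These go to distinct monomials of R, so a combination
that gives a coboundary is a multiple of τh₁³ (`mem_relIdeal_iff`).

That the Yoneda product is the product of R is checked on chain maps: each generator has an explicit
lift to the resolution whose transpose is multiplication by x, y, x w or w² (`coch_h0_mul` and its
analogues). Composites and sums of these, together with scalars, lift enough polynomials to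
represent every cocycle (`IsCocycle.exists_isRepr`), and `SyzygyTower.cls_comp_mapExactFunctor_cls`
says that such lifts compute Yoneda products. -/

noncomputable section

namespace MotivicExt

/-! ### `Ext` groups from a tower of syzygies -/

section SyzygyTower

universe v u w

/-- A projective resolution of `K 0`, cut into short exact sequences
`0 ⟶ K (n + 1) ⟶ P n ⟶ K n ⟶ 0`. -/
structure SyzygyTower (C : Type u) [Category.{v} C] [Abelian C] where
  K : ℕ → C
  P : ℕ → C
  i : ∀ n, K (n + 1) ⟶ P n
  π : ∀ n, P n ⟶ K n
  w : ∀ n, i n ≫ π n = 0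
  exact : ∀ n, (ShortComplex.mk (i n) (π n) (w n)).ShortExact
  projective : ∀ n, Projective (P n)

namespace SyzygyTower

variable {C : Type u} [Category.{v} C] [Abelian C] (S : SyzygyTower C)

instance (n : ℕ) : Projective (S.P n) := S.projective n
instance (n : ℕ) : Epi (S.π n) := (S.exact n).epi_g

/-- The map `K n ⟶ Y` induced by a map `P n ⟶ Y` that vanishes on `K (n + 1)`. -/
def desc (n : ℕ) {Y : C} (f : S.P n ⟶ Y) (hf : S.i n ≫ f = 0) : S.K n ⟶ Y :=
  (S.exact n).exact.desc f hf

@[simp]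
theorem π_desc (n : ℕ) {Y : C} (f : S.P n ⟶ Y) (hf : S.i n ≫ f = 0) :
    S.π n ≫ S.desc n f hf = f := (S.exact n).exact.g_desc f hf

variable [HasExt.{w} C]

/-- The class of `0 ⟶ K n ⟶ P (n - 1) ⟶ ⋯ ⟶ P 0 ⟶ K 0 ⟶ 0`. -/
def yonedaClass : ∀ n : ℕ, Ext.{w} (S.K 0) (S.K n) n
  | 0 => Ext.mk₀ (𝟙 _)
  | n + 1 => (yonedaClass n).comp (S.exact n).extClass rfl

/-- Dimension shifting: positive Ext groups out of `P n` vanish, so the connecting map from Ext^l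
out of `K (n + 1)` to Ext^(l + 1) out of `K n` is onto. -/
theorem exists_yonedaClass_comp {Y : C} (n : ℕ) :
    ∀ (l N : ℕ) (h : n + l = N) (y : Ext.{w} (S.K 0) Y N),
      ∃ y' : Ext.{w} (S.K n) Y l, (S.yonedaClass n).comp y' h = y := by
  induction n with
  | zero =>
    intro l N h y
    obtain rfl : l = N := by omega
    exact ⟨y, Ext.mk₀_id_comp y⟩
  | succ n ih =>
    intro l N h y
    obtain ⟨y', rfl⟩ := ih (l + 1) N (by omega) y
    obtain ⟨y'', hy''⟩ := Ext.contravariant_sequence_exact₃ (S.exact n) Y y'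
      (Ext.eq_zero_of_projective _) (add_comm 1 l)
    refine ⟨y'', ?_⟩
    rw [← hy'']
    exact Ext.comp_assoc _ _ _ _ _ (by omega)

/-- The kernel of a connecting map comes from Ext out of a projective, which vanishes in positive
degree. In degree zero it need not vanish; that is where coboundaries arise. -/
theorem yonedaClass_comp_eq_zero {Y : C} (n : ℕ) :
    ∀ (l N : ℕ) (h : n + (l + 1) = N) (y : Ext.{w} (S.K n) Y (l + 1)),
      (S.yonedaClass n).comp y h = 0 → y = 0 := by
  induction n with
  | zero =>
    intro l N h y hy
    obtain rfl : l + 1 = N := by omega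
    exact (Ext.mk₀_id_comp y).symm.trans hy
  | succ n ih =>
    intro l N h y hy
    have h1 : (S.exact n).extClass.comp y (add_comm 1 (l + 1)) = 0 := by
      refine ih (l + 1) N (by omega) _ (Eq.trans ?_ hy)
      exact (Ext.comp_assoc _ _ _ _ _ (by omega)).symm
    obtain ⟨x, rfl⟩ := Ext.contravariant_sequence_exact₁ (S.exact n) Y y _ h1
    rw [Ext.eq_zero_of_projective x, Ext.comp_zero]

/-- The class in `Ext^n` of a cocycle `P n ⟶ Y`. -/
def cls (n : ℕ) {Y : C} (f : S.P n ⟶ Y) (hf : S.i n ≫ f = 0) : Ext.{w} (S.K 0) Y n :=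
  (S.yonedaClass n).comp (Ext.mk₀ (S.desc n f hf)) (add_zero n)

theorem cls_add (n : ℕ) {Y : C} (f g : S.P n ⟶ Y) (hf : S.i n ≫ f = 0) (hg : S.i n ≫ g = 0)
    (hfg : S.i n ≫ (f + g) = 0) :
    (S.cls n (f + g) hfg : Ext.{w} _ _ _) = S.cls n f hf + S.cls n g hg := by
  have : S.desc n (f + g) hfg = S.desc n f hf + S.desc n g hg := by
    simp [← cancel_epi (S.π n)]
  rw [cls, this, Ext.mk₀_add, Ext.comp_add]; rfl

theorem exists_cls (n : ℕ) {Y : C} (y : Ext.{w} (S.K 0) Y n) :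
    ∃ (f : S.P n ⟶ Y) (hf : S.i n ≫ f = 0), S.cls n f hf = y := by
  obtain ⟨y', rfl⟩ := S.exists_yonedaClass_comp n 0 n (add_zero n) y
  obtain ⟨g, rfl⟩ := (Ext.mk₀_bijective _ _).2 y'
  refine ⟨S.π n ≫ g, by rw [← Category.assoc, S.w, zero_comp], ?_⟩
  rw [cls]
  congr 2
  simp [← cancel_epi (S.π n)]

theorem cls_zero_eq_zero_iff {Y : C} (f : S.P 0 ⟶ Y) (hf : S.i 0 ≫ f = 0) :
    (S.cls 0 f hf : Ext.{w} _ _ _) = 0 ↔ f = 0 := by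
  have : (S.cls 0 f hf : Ext.{w} _ _ _) = Ext.mk₀ (S.desc 0 f hf) := Ext.mk₀_id_comp _
  rw [this, Ext.mk₀_eq_zero_iff, ← cancel_epi (S.π 0), π_desc, comp_zero]

/-- Composition with the first `n` extensions is injective on Ext¹, so only the last extension
matters: its pushout along the map `K (n + 1) ⟶ Y` splits exactly when that map extends to `P n`. -/
theorem cls_succ_eq_zero_iff (n : ℕ) {Y : C} (f : S.P (n + 1) ⟶ Y) (hf : S.i (n + 1) ≫ f = 0) :
    (S.cls (n + 1) f hf : Ext.{w} _ _ _) = 0 ↔ ∃ g : S.P n ⟶ Y, S.π (n + 1) ≫ S.i n ≫ g = f := by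
  have e : (S.cls (n + 1) f hf : Ext.{w} _ _ _) = (S.yonedaClass n).comp
      ((S.exact n).extClass.comp (Ext.mk₀ (S.desc (n + 1) f hf)) (add_zero 1)) rfl :=
    Ext.comp_assoc _ _ _ _ _ (by omega)
  rw [e]
  constructor
  · intro h
    obtain ⟨x, hx⟩ := Ext.contravariant_sequence_exact₁ (S.exact n) Y _ _
      (S.yonedaClass_comp_eq_zero n 0 _ rfl _ h)
    obtain ⟨g, rfl⟩ := (Ext.mk₀_bijective _ _).2 x
    refine ⟨g, ?_⟩
    rw [Ext.mk₀_comp_mk₀] at hx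
    have := (Ext.mk₀_bijective _ _).1 hx
    dsimp at this
    rw [this, π_desc]
  · rintro ⟨g, rfl⟩
    have : S.desc (n + 1) (S.π (n + 1) ≫ S.i n ≫ g) hf = S.i n ≫ g := by
      rw [← cancel_epi (S.π (n + 1)), π_desc]
    rw [this, ← Ext.mk₀_comp_mk₀]
    have h := ShortComplex.ShortExact.extClass_comp_assoc (S.exact n) (Ext.mk₀ g) (h := add_zero 1)
    dsimp at h
    rw [h, Ext.comp_zero]

section Product

variable (F : C ⥤ C) [F.Additive] [PreservesFiniteLimits F] [PreservesFiniteColimits F]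

/-- The product of the class of a cocycle `f` with the image under an exact functor `F` of the
class of a cocycle `g`, in terms of a chain map that lifts `f`. -/
theorem cls_comp_mapExactFunctor_cls (n : ℕ)
    (L : ∀ m, S.P (n + m) ⟶ F.obj (S.P m))
    (hL : ∀ m, L (m + 1) ≫ F.map (S.π (m + 1) ≫ S.i m) = (S.π (n + m + 1) ≫ S.i (n + m)) ≫ L m)
    (hL₀ : S.i n ≫ L 0 ≫ F.map (S.π 0) = 0) (m : ℕ) {Y : C} (g : S.P m ⟶ Y)
    (hg : S.i m ≫ g = 0) (hLg : S.i (n + m) ≫ L m ≫ F.map g = 0) :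
    ((S.cls n (L 0 ≫ F.map (S.π 0)) hL₀ : Ext.{w} _ _ _).comp
      ((S.cls m g hg).mapExactFunctor F) rfl) = S.cls (n + m) (L m ≫ F.map g) hLg := by
  -- The chain map induces maps `κ` of syzygies. Naturality of the extension class for the morphism
  -- `(κ', L m, κ)` of short exact sequences moves `κ` past one extension at a time.
  have key : ∀ m, ∃ κ : S.K (n + m) ⟶ F.obj (S.K m), L m ≫ F.map (S.π m) = S.π (n + m) ≫ κ ∧
      (S.cls n (L 0 ≫ F.map (S.π 0)) hL₀ : Ext.{w} _ _ _).comp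
        ((S.yonedaClass m).mapExactFunctor F) rfl =
      (S.yonedaClass (n + m)).comp (Ext.mk₀ κ) (add_zero _) := by
    intro m
    induction m with
    | zero =>
      refine ⟨S.desc n _ hL₀, (S.π_desc n _ hL₀).symm, ?_⟩
      rw [yonedaClass, Ext.mapExactFunctor_mk₀, F.map_id]
      exact Ext.comp_mk₀_id _
    | succ m ih =>
      obtain ⟨κ, hκ, ih⟩ := ih
      have hF := (S.exact m).map_of_exact F
      have : Mono (F.map (S.i m)) := hF.mono_f
      have hi : (S.i (n + m) ≫ L m) ≫ F.map (S.π m) = 0 := by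
        rw [Category.assoc, hκ, ← Category.assoc, S.w, zero_comp]
      obtain ⟨κ', hκ'⟩ : ∃ κ' : S.K (n + m + 1) ⟶ F.obj (S.K (m + 1)),
          κ' ≫ F.map (S.i m) = S.i (n + m) ≫ L m := by
        have := hF.mono_f
        exact ⟨hF.exact.lift (S.i (n + m) ≫ L m) hi, hF.exact.lift_f _ hi⟩
      refine ⟨κ', ?_, ?_⟩
      · rw [← cancel_mono (F.map (S.i m)), Category.assoc, Category.assoc, hκ', ← F.map_comp]
        exact (hL m).trans (Category.assoc _ _ _)
      · let φ : ShortComplex.mk (S.i (n + m)) (S.π (n + m)) (S.w _) ⟶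
            (ShortComplex.mk (S.i m) (S.π m) (S.w _)).map F :=
          { τ₁ := κ', τ₂ := L m, τ₃ := κ, comm₁₂ := hκ', comm₂₃ := hκ }
        let e : Ext.{w} (S.K (n + m)) (S.K (n + m + 1)) 1 := (S.exact (n + m)).extClass
        let e' : Ext.{w} (F.obj (S.K m)) (F.obj (S.K (m + 1))) 1 := hF.extClass
        have nat : e.comp (Ext.mk₀ κ') (add_zero 1) = (Ext.mk₀ κ).comp e' (zero_add 1) :=
          ShortComplex.ShortExact.extClass_naturality.{w} (S.exact (n + m)) hF φ
        have h1 : (S.yonedaClass (m + 1)).mapExactFunctor F =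
            ((S.yonedaClass m).mapExactFunctor F).comp e' rfl :=
          (Ext.mapExactFunctor_comp F _ _ _).trans
            (congrArg (fun z => ((S.yonedaClass m).mapExactFunctor F).comp z rfl)
              (Ext.mapExactFunctor_extClass F (S.exact m)))
        have h2 : S.yonedaClass (n + (m + 1)) = (S.yonedaClass (n + m)).comp e rfl := rfl
        rw [h1, h2]
        refine (Ext.comp_assoc (a₁₂ := n + m) _ _ _ rfl rfl (by omega)).symm.trans ?_
        rw [ih, Ext.comp_assoc_of_second_deg_zero, ← nat]
        exact (Ext.comp_assoc _ _ _ _ _ (by omega)).symm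
  obtain ⟨κ, hκ, h⟩ := key m
  have e : S.desc (n + m) (L m ≫ F.map g) hLg = κ ≫ F.map (S.desc m g hg) := by
    rw [← cancel_epi (S.π (n + m)), π_desc, ← Category.assoc, ← hκ, Category.assoc, ← F.map_comp,
      π_desc]
  rw [cls, cls, cls, Ext.mapExactFunctor_comp, Ext.mapExactFunctor_mk₀, e, ← Ext.mk₀_comp_mk₀,
    ← Ext.comp_assoc_of_third_deg_zero, ← Ext.comp_assoc_of_third_deg_zero]
  exact congrArg (fun z => z.comp (Ext.mk₀ (F.map (S.desc m g hg))) (add_zero _)) h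

theorem cls_comp_mk₀ (n : ℕ) {Y Z : C} (f : S.P n ⟶ Y) (hf : S.i n ≫ f = 0) (g : Y ⟶ Z)
    (hfg : S.i n ≫ f ≫ g = 0) :
    (S.cls n f hf : Ext.{w} _ _ _).comp (Ext.mk₀ g) (add_zero n) = S.cls n (f ≫ g) hfg := by
  have : S.desc n (f ≫ g) hfg = S.desc n f hf ≫ g := by
    rw [← cancel_epi (S.π n), ← Category.assoc, π_desc, π_desc]
  rw [cls, cls, this, ← Ext.mk₀_comp_mk₀, Ext.comp_assoc_of_third_deg_zero]

end Product

end SyzygyTower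

end SyzygyTower

/-! ### The structure of `A(1)` -/

instance : CharP M2 2 := inferInstance

theorem adem_rel (a b : ℕ) (ha : 0 < a) (hab : a < 2 * b) :
    Sq a * Sq b = ∑ j ∈ Finset.range (a / 2 + 1),
      (((b - 1 - j).choose (a - 2 * j) : M2) *
        tau ^ (if Even a ∧ Even b ∧ Odd j then 1 else 0)) • (Sq (a + b - j) * Sq j) := by
  have h := RingQuot.mkAlgHom_rel M2 (AdemRel.adem a b ha hab)
  rw [map_mul, map_sum] at h
  refine h.trans (Finset.sum_congr rfl fun j _ => ?_)
  rw [map_smul, map_mul]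
  rfl

theorem Sq_zero : Sq 0 = 1 :=
  (RingQuot.mkAlgHom_rel M2 AdemRel.sq_zero).trans (map_one _)

theorem Sq_one_mul_Sq_one : Sq 1 * Sq 1 = 0 := by
  rw [adem_rel 1 1 (by norm_num) (by norm_num)]
  simp

theorem Sq_one_mul_Sq_two : Sq 1 * Sq 2 = Sq 3 := by
  rw [adem_rel 1 2 (by norm_num) (by norm_num)]
  simp [Sq_zero]

theorem Sq_two_mul_Sq_two : Sq 2 * Sq 2 = tau • (Sq 3 * Sq 1) := by
  rw [adem_rel 2 2 (by norm_num) (by norm_num)]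
  simp [Finset.sum_range_succ]

theorem Sq_two_mul_Sq_three : Sq 2 * Sq 3 = Sq 5 + Sq 4 * Sq 1 := by
  rw [adem_rel 2 3 (by norm_num) (by norm_num)]
  simp [Finset.sum_range_succ, Sq_zero, show ¬ Even 3 by decide]

theorem Sq_three_mul_Sq_three : Sq 3 * Sq 3 = Sq 5 * Sq 1 := by
  rw [adem_rel 3 3 (by norm_num) (by norm_num)]
  simp [Finset.sum_range_succ, Sq_zero, show ¬ Even 3 by decide]

/-- `Sq^1` as an element of `A(1)`. -/
def sqA : A1 := ⟨Sq 1, Algebra.subset_adjoin (by simp)⟩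

/-- `Sq^2` as an element of `A(1)`. -/
def sqB : A1 := ⟨Sq 2, Algebra.subset_adjoin (by simp)⟩

theorem sqA_mul_sqA : sqA * sqA = 0 := Subtype.ext Sq_one_mul_Sq_one

theorem sqB_mul_sqB : sqB * sqB = tau • (sqA * (sqB * sqA)) := Subtype.ext <| by
  change Sq 2 * Sq 2 = tau • (Sq 1 * (Sq 2 * Sq 1))
  rw [Sq_two_mul_Sq_two, ← Sq_one_mul_Sq_two, mul_assoc]

theorem sqB_mul_sqA_mul_sqB_mul_sqA :
    sqB * (sqA * (sqB * sqA)) = sqA * (sqB * (sqA * sqB)) := Subtype.ext <| by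
  change Sq 2 * (Sq 1 * (Sq 2 * Sq 1)) = Sq 1 * (Sq 2 * (Sq 1 * Sq 2))
  rw [← mul_assoc (Sq 1) (Sq 2), ← mul_assoc (Sq 1) (Sq 2), Sq_one_mul_Sq_two,
    Sq_three_mul_Sq_three, ← mul_assoc, Sq_two_mul_Sq_three, add_mul, mul_assoc,
    Sq_one_mul_Sq_one, mul_zero, add_zero]

/-! ### The basis of `A(1)`. -/

/-- The operators on `𝔽₂[τ]^8` through which `Sq^1` and `Sq^2` act on `A(1)`, with an extension to
all the `Sq^n`. -/
def sqVec (n : ℕ) (v : Fin 8 → M2) : Fin 8 → M2 :=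
  match n with
  | 0 => v
  | 1 => ![0, v 0, 0, v 2, 0, v 4, 0, v 6]
  | 2 => ![0, 0, v 0, 0, v 1, tau * v 2, v 3, v 5]
  | 3 => ![0, 0, 0, v 0, 0, v 1, 0, v 3]
  -- `Sq^4` cannot act by zero: on the first basis vector, `Sq^2 Sq^3 = Sq^5 + Sq^4 Sq^1` has the
  -- seventh one as its value while `Sq^5` gives zero.
  | 4 => ![0, 0, 0, 0, 0, 0, v 1, 0]
  | 5 => ![0, 0, 0, 0, 0, 0, 0, v 1]
  -- Forced by `Sq^2 Sq^4 = Sq^6 + τ Sq^5 Sq^1`, since `Sq^4` kills the first basis vector.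
  | 6 => ![0, 0, 0, 0, 0, 0, 0, tau * v 0]
  | _ => 0

def sqEnd (n : ℕ) : Module.End M2 (Fin 8 → M2) where
  toFun := sqVec n
  map_add' v w := by
    unfold sqVec
    ext i
    split <;> fin_cases i <;> simp [mul_add]
  map_smul' c v := by
    unfold sqVec
    ext i
    split <;> fin_cases i <;> simp [mul_left_comm]

theorem sqEnd_eq_zero {n : ℕ} (hn : 6 < n) : sqEnd n = 0 := by
  obtain ⟨m, rfl⟩ := Nat.exists_eq_add_of_le' hn
  rfl

set_option maxHeartbeats 4000000 in
-- A finite check: if `a` or `b` exceeds 6, then so does every `a + b - j` with `j ≤ a / 2`, and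
-- both sides vanish. The remaining cases are evaluated with the binomial coefficients reduced mod
-- 2.
theorem sqEnd_adem (a b : ℕ) (ha : 0 < a) (hab : a < 2 * b) :
    sqEnd a * sqEnd b = ∑ j ∈ Finset.range (a / 2 + 1),
      (((b - 1 - j).choose (a - 2 * j) : M2) *
        tau ^ (if Even a ∧ Even b ∧ Odd j then 1 else 0)) • (sqEnd (a + b - j) * sqEnd j) := by
  by_cases h : 6 < a ∨ 6 < b
  · rw [Finset.sum_eq_zero fun j hj => ?_]
    · rcases h with h | h <;> simp [sqEnd_eq_zero h]
    · rw [Finset.mem_range] at hj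
      rw [sqEnd_eq_zero (by omega : 6 < a + b - j), zero_mul, smul_zero]
  · push Not at h
    obtain ⟨ha', hb'⟩ := h
    have hb : 0 < b := by omega
    have two : (2 : M2) = 0 := CharTwo.two_eq_zero
    have three : (3 : M2) = 1 := by linear_combination two
    have four : (4 : M2) = 0 := by linear_combination 2 * two
    refine LinearMap.ext fun v => ?_
    simp only [LinearMap.sum_apply, LinearMap.smul_apply, Module.End.mul_apply]
    change sqVec a (sqVec b v) = ∑ j ∈ Finset.range (a / 2 + 1), (_ : M2) •
      sqVec (a + b - j) (sqVec j v)
    interval_cases a <;> interval_cases b <;> first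
      | (exfalso; omega)
      | (norm_num [Finset.sum_range_succ, Nat.choose, two, sqVec, Nat.even_iff, Nat.odd_iff]
         repeat' apply And.intro
         all_goals first
           | rfl
           | exact Subsingleton.elim _ _
           | exact Or.inl rfl
           | exact Or.inl two
           | exact Or.inr rfl
           | exact (congrArg (· * v 1) three).trans (one_mul _) |>.symm
           | exact (congrArg (· * (tau * v 0)) four).trans (zero_mul _) |>.symm
           | (rw [three, one_mul]; exact (CharTwo.add_self_eq_zero _).symm))

/-- A representation of the motivic Steenrod algebra whose restriction to `A(1)` is free of
rank one. -/
def steenrodRep : Steenrod →ₐ[M2] Module.End M2 (Fin 8 → M2) :=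
  RingQuot.liftAlgHom M2 ⟨FreeAlgebra.lift M2 sqEnd, by
    rintro _ _ (_ | ⟨a, b, ha, hab⟩)
    · rw [FreeAlgebra.lift_ι_apply, map_one]; rfl
    · simp only [map_mul, map_sum, map_smul, FreeAlgebra.lift_ι_apply]
      exact sqEnd_adem a b ha hab⟩

theorem steenrodRep_Sq (n : ℕ) : steenrodRep (Sq n) = sqEnd n :=
  (RingQuot.liftAlgHom_mkAlgHom_apply _ _ _ _).trans (FreeAlgebra.lift_ι_apply _ _)

@[simp] theorem sqA_sqA : sqA * sqA = 0 := sqA_mul_sqA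

@[simp] theorem sqA_sqA_assoc (x : A1) : sqA * (sqA * x) = 0 := by
  rw [← mul_assoc, sqA_mul_sqA, zero_mul]

@[simp] theorem sqB_sqB_assoc (x : A1) : sqB * (sqB * x) = tau • (sqA * (sqB * (sqA * x))) := by
  rw [← mul_assoc, sqB_mul_sqB, smul_mul_assoc, mul_assoc, mul_assoc]

@[simp] theorem sqB_sqA_sqB_sqA_assoc (x : A1) :
    sqB * (sqA * (sqB * (sqA * x))) = sqA * (sqB * (sqA * (sqB * x))) := by
  simpa only [mul_assoc] using congrArg (· * x) sqB_mul_sqA_mul_sqB_mul_sqA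

attribute [simp] sqB_mul_sqB sqB_mul_sqA_mul_sqB_mul_sqA

/-- The monomials that form a basis of `A(1)`. -/
def a1Mon : Fin 8 → A1 :=
  ![1, sqA, sqB, sqA * sqB, sqB * sqA, sqA * (sqB * sqA), sqB * (sqA * sqB),
    sqA * (sqB * (sqA * sqB))]

/-- The bidegrees of the basis of `A(1)`. -/
def a1Deg : Fin 8 → ℤ × ℤ :=
  ![(0, 0), (1, 0), (2, 1), (3, 1), (3, 1), (4, 1), (5, 2), (6, 2)]

/-- The coordinates of an element of `A(1)`. -/
def a1Coord : A1 →ₗ[M2] (Fin 8 → M2) :=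
  LinearMap.applyₗ (Pi.single 0 1 : Fin 8 → M2) ∘ₗ steenrodRep.toLinearMap ∘ₗ A1.val.toLinearMap

theorem a1Coord_one : a1Coord 1 = Pi.single 0 1 := by
  change steenrodRep 1 _ = _
  rw [map_one]; rfl

theorem a1Coord_sqA_mul (x : A1) : a1Coord (sqA * x) = sqVec 1 (a1Coord x) := by
  change steenrodRep (Sq 1 * x.1) _ = _
  rw [map_mul, steenrodRep_Sq]; rfl

theorem a1Coord_sqB_mul (x : A1) : a1Coord (sqB * x) = sqVec 2 (a1Coord x) := by
  change steenrodRep (Sq 2 * x.1) _ = _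
  rw [map_mul, steenrodRep_Sq]; rfl

theorem a1Coord_a1Mon (i : Fin 8) : a1Coord (a1Mon i) = Pi.single i 1 := by
  have hA : a1Coord sqA = sqVec 1 (a1Coord 1) := by rw [← a1Coord_sqA_mul, mul_one]
  have hB : a1Coord sqB = sqVec 2 (a1Coord 1) := by rw [← a1Coord_sqB_mul, mul_one]
  ext j : 1
  fin_cases i <;>
    simp only [a1Mon, a1Coord_sqA_mul, a1Coord_sqB_mul, hA, hB, a1Coord_one, Fin.zero_eta,
      Fin.mk_one, Fin.reduceFinMk, Matrix.cons_val, Matrix.cons_val_zero, Matrix.cons_val_one] <;>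
    fin_cases j <;> simp [sqVec]

/-- The Adem relations could a priori impose further linear relations on these monomials. Their
action on the first unit vector of the representation, which gives all the unit vectors, rules this
out. -/
theorem a1Mon_linearIndependent : LinearIndependent M2 a1Mon := by
  refine LinearIndependent.of_comp a1Coord ?_
  rw [show a1Coord ∘ a1Mon = fun i => Pi.single i 1 from funext a1Coord_a1Mon]
  convert (Pi.basisFun M2 (Fin 8)).linearIndependent
  simp

/-- The span contains 1 and, by the three relations, is stable under left multiplication by both
generators. -/
theorem a1Mon_span : ⊤ ≤ Submodule.span M2 (Set.range a1Mon) := by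
  set T := Submodule.span M2 (Set.range a1Mon)
  have hm (i : Fin 8) : a1Mon i ∈ T := Submodule.subset_span ⟨i, rfl⟩
  have hA : ∀ y ∈ T, sqA * y ∈ T := fun y hy => by
    induction hy using Submodule.span_induction with
    | mem y hy =>
      obtain ⟨i, rfl⟩ := hy
      have h1 := hm 1
      have h3 := hm 3
      have h5 := hm 5
      have h7 := hm 7
      simp only [a1Mon, Matrix.cons_val, Matrix.cons_val_one] at h1 h3 h5 h7
      fin_cases i <;> simp [a1Mon, *]
    | zero => simp
    | add y z _ _ h h' => rw [mul_add]; exact add_mem h h'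
    | smul c y _ h => rw [mul_smul_comm]; exact T.smul_mem c h
  have hB : ∀ y ∈ T, sqB * y ∈ T := fun y hy => by
    induction hy using Submodule.span_induction with
    | mem y hy =>
      obtain ⟨i, rfl⟩ := hy
      have h2 := hm 2
      have h4 := hm 4
      have h5 := T.smul_mem tau (hm 5)
      have h6 := hm 6
      have h7 := hm 7
      simp only [a1Mon, Matrix.cons_val] at h2 h4 h5 h6 h7
      fin_cases i <;> simp [a1Mon, *]
    | zero => simp
    | add y z _ _ h h' => rw [mul_add]; exact add_mem h h'
    | smul c y _ h => rw [mul_smul_comm]; exact T.smul_mem c h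
  have key : ∀ (x : Steenrod) (hx : x ∈ A1), ∀ y ∈ T, (⟨x, hx⟩ : A1) * y ∈ T := fun x hx => by
    induction hx using Algebra.adjoin_induction with
    | mem x hx =>
      obtain rfl | rfl := hx
      · exact hA
      · exact hB
    | algebraMap c =>
      intro y hy
      have : (⟨algebraMap M2 Steenrod c, A1.algebraMap_mem c⟩ : A1) * y = c • y :=
        (Algebra.smul_def c y).symm
      rw [this]
      exact T.smul_mem c hy
    | add x z hx hz h h' =>
      intro y hy
      have : (⟨x + z, add_mem hx hz⟩ : A1) * y = ⟨x, hx⟩ * y + ⟨z, hz⟩ * y :=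
        add_mul (⟨x, hx⟩ : A1) ⟨z, hz⟩ y
      rw [this]
      exact add_mem (h y hy) (h' y hy)
    | mul x z hx hz h h' =>
      intro y hy
      have : (⟨x * z, mul_mem hx hz⟩ : A1) * y = ⟨x, hx⟩ * (⟨z, hz⟩ * y) :=
        mul_assoc (⟨x, hx⟩ : A1) ⟨z, hz⟩ y
      rw [this]
      exact h _ (h' y hy)
  intro x _
  have := key x.1 x.2 1 (hm 0)
  rwa [mul_one] at this

/-- The basis of `A(1)` over `𝔽₂[τ]`. -/
def a1Basis : Module.Basis (Fin 8) M2 A1 := .mk a1Mon_linearIndependent a1Mon_span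

@[simp] theorem a1Basis_apply (i : Fin 8) : a1Basis i = a1Mon i := by simp [a1Basis]

theorem a1Coord_eq_repr (x : A1) : a1Coord x = a1Basis.repr x := by
  have : a1Coord = (Finsupp.linearEquivFunOnFinite M2 M2 (Fin 8)).toLinearMap ∘ₗ
      a1Basis.repr.toLinearMap := a1Basis.ext fun i => by
    rw [a1Basis_apply, a1Coord_a1Mon, ← a1Basis_apply]
    simp [-a1Basis_apply]
  rw [this]; rfl

theorem sum_a1Coord (x : A1) : ∑ i, a1Coord x i • a1Mon i = x := by
  simpa [a1Coord_eq_repr] using a1Basis.sum_repr x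

/-! ### Gradings -/

theorem sqA_mem : sqA ∈ gradA1 (1, 0) := AddSubgroup.subset_closure ⟨0, [1], by simp, by simp; rfl⟩

theorem sqB_mem : sqB ∈ gradA1 (2, 1) := AddSubgroup.subset_closure ⟨0, [2], by simp, by simp; rfl⟩

theorem one_mem_gradA1 : (1 : A1) ∈ gradA1 (0, 0) := SetLike.GradedOne.one_mem

theorem mul_mem_gradA1 {d e f : ℤ × ℤ} {x y : A1} (hx : x ∈ gradA1 d) (hy : y ∈ gradA1 e)
    (h : d + e = f) : x * y ∈ gradA1 f := h ▸ SetLike.GradedMul.mul_mem hx hy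

/-- The bidegree fixes the exponent of τ, and 𝔽₂ has only one nonzero scalar. -/
theorem gradM2_eq_zero_or {d : ℤ × ℤ} {p : M2} (hp : p ∈ gradM2 d) :
    p = 0 ∨ ∃ k : ℕ, p = tau ^ k ∧ d = (0, (k : ℤ)) := by
  by_cases h : p = 0
  · exact .inl h
  · obtain ⟨k, hk⟩ : ∃ k, p.coeff k ≠ 0 := by
      by_contra! h'
      exact h (Polynomial.ext (by simpa using h'))
    have hd := hp k hk
    refine .inr ⟨k, ?_, hd.symm⟩
    ext j
    rw [tau, Polynomial.coeff_X_pow]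
    split_ifs with hj
    · subst hj
      exact (by decide : ∀ z : ZMod 2, z ≠ 0 → z = 1) _ hk
    · by_contra hj'
      have := (hp j hj').trans hd.symm
      simp at this
      omega

theorem smul_mem_gradA1 {d e f : ℤ × ℤ} {p : M2} {x : A1} (hp : p ∈ gradM2 d) (hx : x ∈ gradA1 e)
    (h : d + e = f) : p • x ∈ gradA1 f := by
  obtain rfl | ⟨k, rfl, rfl⟩ := gradM2_eq_zero_or hp
  · rw [zero_smul]; exact zero_mem _
  · rw [← one_mul x, ← smul_mul_assoc]
    refine mul_mem_gradA1 ?_ hx h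
    exact AddSubgroup.subset_closure ⟨k, [], by simp, by simp⟩

theorem mul_mem_gradM2 {d e f : ℤ × ℤ} {p q : M2} (hp : p ∈ gradM2 d) (hq : q ∈ gradM2 e)
    (h : d + e = f) : p * q ∈ gradM2 f := h ▸ SetLike.GradedMul.mul_mem hp hq

theorem tau_mem : tau ∈ gradM2 (0, 1) := by simpa using tau_pow_mem 1

theorem a1Mon_mem (i : Fin 8) : a1Mon i ∈ gradA1 (a1Deg i) := by
  have hAB := mul_mem_gradA1 sqA_mem sqB_mem (f := (3, 1)) rfl
  have hBA := mul_mem_gradA1 sqB_mem sqA_mem (f := (3, 1)) rfl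
  have hABA := mul_mem_gradA1 sqA_mem hBA (f := (4, 1)) rfl
  have hBAB := mul_mem_gradA1 sqB_mem hAB (f := (5, 2)) rfl
  have hABAB := mul_mem_gradA1 sqA_mem hBAB (f := (6, 2)) rfl
  fin_cases i
  exacts [one_mem_gradA1, sqA_mem, sqB_mem, hAB, hBA, hABA, hBAB, hABAB]

set_option linter.unnecessarySeqFocus false in
theorem sqVec_mem (n : ℕ) {v : Fin 8 → M2} {d : ℤ × ℤ} (hv : ∀ i, v i ∈ gradM2 (d - a1Deg i))
    (i : Fin 8) : sqVec n v i ∈ gradM2 (((n : ℤ), ((n / 2 : ℕ) : ℤ)) + d - a1Deg i) := by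
  have hv' (j : Fin 8) (h : d - a1Deg j = ((n : ℤ), ((n / 2 : ℕ) : ℤ)) + d - a1Deg i) :
      v j ∈ gradM2 (((n : ℤ), ((n / 2 : ℕ) : ℤ)) + d - a1Deg i) := h ▸ hv j
  have hv'' (j : Fin 8) (h : (0, 1) + (d - a1Deg j) = ((n : ℤ), ((n / 2 : ℕ) : ℤ)) + d - a1Deg i) :
      tau * v j ∈ gradM2 (((n : ℤ), ((n / 2 : ℕ) : ℤ)) + d - a1Deg i) :=
    mul_mem_gradM2 tau_mem (hv j) h
  obtain ⟨d₁, d₂⟩ := d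
  unfold sqVec
  split
  all_goals try (exact zero_mem _)
  · exact hv' i (by simp)
  all_goals fin_cases i
  all_goals first
    | exact zero_mem _
    | exact hv' 0 (by ext <;> simp [a1Deg] <;> ring)
    | exact hv' 1 (by ext <;> simp [a1Deg] <;> ring)
    | exact hv' 2 (by ext <;> simp [a1Deg] <;> ring)
    | exact hv' 3 (by ext <;> simp [a1Deg] <;> ring)
    | exact hv' 4 (by ext <;> simp [a1Deg] <;> ring)
    | exact hv' 5 (by ext <;> simp [a1Deg] <;> ring)
    | exact hv' 6 (by ext <;> simp [a1Deg] <;> ring)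
    | exact hv'' 0 (by ext <;> simp [a1Deg] <;> ring)
    | exact hv'' 2 (by ext <;> simp [a1Deg] <;> ring)

/-- The representation is compatible with the bigrading (`sqVec_mem`). Homogeneity of coordinates is
needed for the contracting homotopy, which is linear only over 𝔽₂[τ] and hence given on the basis.
-/
theorem a1Coord_mem {d : ℤ × ℤ} {x : A1} (hx : x ∈ gradA1 d) (i : Fin 8) :
    a1Coord x i ∈ gradM2 (d - a1Deg i) := by
  have key : ∀ (x : Steenrod), x ∈ gradSteenrod d → ∀ i, steenrodRep x (Pi.single 0 1) i ∈
      gradM2 (d - a1Deg i) := fun x hx => by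
    induction hx using AddSubgroup.closure_induction with
    | mem x hx =>
      obtain ⟨k, l, rfl, rfl⟩ := hx
      rw [map_smul]
      clear hx
      have hl : ∀ i, steenrodRep (l.map Sq).prod (Pi.single 0 1) i ∈
          gradM2 ((((l.sum : ℕ) : ℤ), (((l.map (· / 2)).sum : ℕ) : ℤ)) - a1Deg i) := by
        induction l with
        | nil =>
          intro i
          rw [show (List.map Sq []).prod = 1 from List.prod_nil, map_one]
          by_cases h : i = 0
          · subst h
            exact tau_pow_mem 0
          · rw [Module.End.one_apply, Pi.single_eq_of_ne h]
            exact zero_mem _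
        | cons n l ih =>
          intro i
          rw [show (List.map Sq (n :: l)).prod = Sq n * (List.map Sq l).prod from List.prod_cons,
            map_mul, steenrodRep_Sq]
          have := sqVec_mem n ih i
          rw [Module.End.mul_apply]
          change sqVec n _ i ∈ _
          simpa only [List.map_cons, List.sum_cons, Nat.cast_add, Prod.mk_add_mk] using this
      intro i
      refine mul_mem_gradM2 (tau_pow_mem k) (hl i) ?_
      ext
      · simp
      · simp
        ring
    | zero => intro i; rw [map_zero]; exact zero_mem _
    | add y z _ _ h h' => intro i; rw [map_add]; exact add_mem (h i) (h' i)
    | neg y _ h => intro i; rw [map_neg]; exact neg_mem (h i)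
  exact key x.1 hx i

/-- The augmentation of `A(1)`. -/
def aug : A1 →ₐ[M2] M2 := augmentation.comp A1.val

@[simp] theorem aug_sqA : aug sqA = 0 := (augmentation_Sq 1).trans (if_neg one_ne_zero)

@[simp] theorem aug_sqB : aug sqB = 0 := (augmentation_Sq 2).trans (if_neg two_ne_zero)

set_option linter.unusedSimpArgs false

/-! ### A free resolution of `𝔽₂[τ]` over `A(1)` -/

/-- The monomials in `x, y, w` with `x y = 0`. -/
inductive RMon : Type
  /-- `w ^ k` -/
  | W (k : ℕ)
  /-- `x ^ (i + 1) w ^ k` -/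
  | X (i k : ℕ)
  /-- `y ^ (j + 1) w ^ k` -/
  | Y (j k : ℕ)
  deriving DecidableEq

namespace RMon

/-- The homological degree, in which `x`, `y`, `w` have degree `1`, `1`, `2`. -/
def hdeg : RMon → ℤ
  | W k => 2 * k
  | X i k => i + 1 + 2 * k
  | Y j k => j + 1 + 2 * k

/-- The internal bidegree, in which `x`, `y`, `w` have bidegree `(1, 0)`, `(2, 1)`, `(6, 2)`. -/
def ideg : RMon → ℤ × ℤ
  | W k => (6 * k, 2 * k)
  | X i k => (i + 1 + 6 * k, 2 * k)
  | Y j k => (2 * (j + 1) + 6 * k, j + 1 + 2 * k)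

end RMon

/-- The free `A(1)`-module on the monomials, which underlies the resolution. -/
abbrev Res : Type := RMon →₀ A1

/-- The multiple `x g` of the generator `g` of the resolution. -/
def gen (g : RMon) (x : A1) : Res := Finsupp.single g x

theorem gen_zero (g : RMon) : gen g 0 = 0 := Finsupp.single_zero g

theorem smul_gen (g : RMon) (x y : A1) : x • gen g y = gen g (x * y) := Finsupp.smul_single x g y

theorem gen_smul (g : RMon) (c : M2) (x : A1) : gen g (c • x) = c • gen g x :=
  (Finsupp.smul_single c g x).symm

theorem res_add_self (z : Res) : z + z = 0 := by
  have : (2 : M2) • z = 0 := by simp only [CharTwo.two_eq_zero (R := M2), zero_smul]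
  rwa [two_smul] at this

theorem res_add_cancel (y z : Res) : y + (y + z) = z := by rw [← add_assoc, res_add_self, zero_add]

/-- The generator `f (k - 1)`, multiplied by `x`, or zero for `k = 0`. -/
def genPred (f : ℕ → RMon) : ℕ → A1 → Res
  | 0, _ => 0
  | k + 1, x => gen (f k) x

/-- `p` for even `k` and zero for odd `k`. -/
def ev : ℕ → Res → Res
  | 0, p => p
  | 1, _ => 0
  | k + 2, p => ev k p

theorem ev_pos {k : ℕ} (h : Even k) (z : Res) : ev k z = z := by
  induction k using Nat.twoStepInduction with
  | zero => rfl
  | one => exact absurd h (by decide)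
  | more k ih _ => exact ih (by simpa [Nat.even_add] using h)

theorem ev_neg {k : ℕ} (h : ¬ Even k) (z : Res) : ev k z = 0 := by
  induction k using Nat.twoStepInduction with
  | zero => exact absurd (by decide) h
  | one => rfl
  | more k ih _ => exact ih (by simpa [Nat.even_add] using h)

/-- A case distinction that determines the values of `genPred` and `ev`. -/
theorem even_cases {p : ℕ → Prop} (h0 : p 0) (h1 : p 1) (h2 : p 2)
    (h3 : ∀ k, (∀ z, ev k z = z) → (∀ z, ev (k + 1) z = 0) → p (k + 3))
    (h4 : ∀ k, (∀ z, ev k z = 0) → (∀ z, ev (k + 1) z = z) → p (k + 3)) : ∀ k, p k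
  | 0 => h0
  | 1 => h1
  | 2 => h2
  | k + 3 => by
    by_cases h : Even k
    · exact h3 k (ev_pos h) (ev_neg (by simpa [Nat.even_add_one] using h))
    · exact h4 k (ev_neg h) (ev_pos (by simpa [Nat.even_add_one] using h))

/-- The differential on generators. -/
def diffGen : RMon → Res
  -- In homological degree 2 the generators `.X 1 0`, `.Y 1 0` and `.W 1` encode the three relations
  -- of `A(1)`; the later formulas continue this pattern along powers of x, y and w.
  | .W k => genPred (.Y 0) k (sqA * (sqB * sqA)) + genPred (.X 0) k (sqB * (sqA * sqB))
  | .X 0 k => gen (.W k) sqA + genPred (.X 1) k (sqB * (sqA * sqB))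
  | .X (i + 1) k => gen (.X i k) sqA + genPred (.X (i + 2)) k (sqB * (sqA * sqB))
  | .Y 0 k => gen (.W k) sqB + genPred (.Y 1) k (sqA * (sqB * sqA))
  | .Y 1 k => gen (.Y 0 k) sqB + genPred (.Y 2) k (sqA * (sqB * sqA)) +
      ev k (gen (.X 0 k) (tau • (sqA * sqB)))
  -- The terms with coefficient τ·1, here and in the next case, are the only ones of nonzero
  -- augmentation. They are dual to d(w^{k+1}) = (k + 1) τ y³ w^k, which explains the restriction to
  -- even `k`.
  | .Y 2 k => gen (.Y 1 k) sqB + genPred (.Y 3) k (sqA * (sqB * sqA)) +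
      ev k (gen (.W (k + 1)) (tau • 1))
  | .Y (j + 3) k => gen (.Y (j + 2) k) sqB + genPred (.Y (j + 4)) k (sqA * (sqB * sqA)) +
      ev k (gen (.Y j (k + 1)) (tau • 1))

/-- The linear endomorphism of the resolution with given values on the generators. -/
def resLift (G : RMon → Res) : Res →ₗ[A1] Res := Finsupp.linearCombination A1 G

theorem resLift_gen (G : RMon → Res) (g : RMon) (x : A1) : resLift G (gen g x) = x • G g :=
  Finsupp.linearCombination_single _ _ _

theorem res_hom_ext {f f' : Res →ₗ[A1] Res} (h : ∀ g, f (gen g 1) = f' (gen g 1)) : f = f' :=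
  Finsupp.lhom_ext' fun g => LinearMap.ext_ring (h g)

theorem smul_genPred (f : ℕ → RMon) (k : ℕ) (x y : A1) :
    x • genPred f k y = genPred f k (x * y) := by
  cases k with
  | zero => exact smul_zero _
  | succ k => exact smul_gen _ _ _

theorem genPred_zero (f : ℕ → RMon) (k : ℕ) : genPred f k 0 = 0 := by
  cases k with
  | zero => rfl
  | succ k => exact gen_zero _

/-- Rewriting rules for `A(1)`-linear maps between free modules. -/
theorem res_rules :
    (∀ G y z, resLift G (y + z) = resLift G y + resLift G z) ∧ (∀ G, resLift G 0 = 0) ∧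
    (∀ G g x, resLift G (gen g x) = x • G g) ∧
    (∀ (x : A1) (y z : Res), x • (y + z) = x • y + x • z) ∧ (∀ x : A1, x • (0 : Res) = 0) ∧
    (∀ z : Res, z + 0 = z) ∧ (∀ z : Res, 0 + z = z) ∧
    (∀ y z t : Res, y + z + t = y + (z + t)) ∧
    (∀ g x y, x • gen g y = gen g (x * y)) ∧ (∀ g, gen g 0 = 0) ∧
    (∀ f k x y, x • genPred f k y = genPred f k (x * y)) ∧ (∀ f k, genPred f k 0 = 0) ∧
    (∀ x y z : A1, x * y * z = x * (y * z)) ∧ (∀ x : A1, x * 1 = x) ∧ (∀ x : A1, 1 * x = x) ∧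
    (∀ x : A1, x * 0 = 0) ∧ (∀ x y : A1, x * tau • y = tau • (x * y)) ∧
    (∀ x y : A1, (tau • x) * y = tau • (x * y)) ∧ tau • (0 : A1) = 0 ∧
    sqA * sqA = 0 ∧ (∀ x, sqA * (sqA * x) = 0) ∧ sqB * sqB = tau • (sqA * (sqB * sqA)) ∧
    (∀ x, sqB * (sqB * x) = tau • (sqA * (sqB * (sqA * x)))) ∧
    sqB * (sqA * (sqB * sqA)) = sqA * (sqB * (sqA * sqB)) ∧
    (∀ x, sqB * (sqA * (sqB * (sqA * x))) = sqA * (sqB * (sqA * (sqB * x)))) :=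
  ⟨fun _ => map_add _, fun _ => map_zero _, resLift_gen, smul_add, smul_zero, add_zero, zero_add,
    add_assoc, smul_gen, gen_zero, smul_genPred, genPred_zero, mul_assoc, mul_one, one_mul,
    mul_zero, fun _ _ => mul_smul_comm _ _ _, fun _ _ => smul_mul_assoc _ _ _, smul_zero _,
    sqA_sqA, sqA_sqA_assoc, sqB_mul_sqB, sqB_sqB_assoc, sqB_mul_sqA_mul_sqB_mul_sqA,
    sqB_sqA_sqB_sqA_assoc⟩

/-- Rewriting rules for sums in characteristic two. -/
theorem res_add_rules : (∀ y z : Res, y + z = z + y) ∧ (∀ y z t : Res, y + (z + t) = z + (y + t)) ∧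
    (∀ z : Res, z + z = 0) ∧ (∀ y z : Res, y + (y + z) = z) ∧ (∀ z : Res, z + 0 = z) ∧
    (∀ z : Res, 0 + z = z) :=
  ⟨add_comm, add_left_comm, res_add_self, res_add_cancel, add_zero, zero_add⟩

/-- The differential of the resolution. -/
def diff : Res →ₗ[A1] Res := resLift diffGen

set_option maxHeartbeats 400000 in
theorem diff_diff (z : Res) : diff (diff z) = 0 := by
  suffices diff ∘ₗ diff = 0 from LinearMap.congr_fun this z
  refine res_hom_ext fun g => ?_
  change resLift diffGen (resLift diffGen (gen g 1)) = 0
  rw [resLift_gen, one_smul]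
  rcases g with k | ⟨_ | _ | i, k⟩ | ⟨_ | _ | _ | _ | _ | _ | j, k⟩ <;> revert k <;>
    refine even_cases ?_ ?_ ?_ ?_ ?_ <;> intros <;>
    simp only [*, diffGen, genPred, ev, res_rules, Nat.add_assoc, Nat.reduceAdd] <;>
    simp only [res_add_rules]

/-! ### Chain maps that lift the four generators. -/

/-- The chain map that lifts `h₀`. -/
def h0Gen : RMon → Res
  | .W k => genPred (.Y 0) k (sqB * sqA)
  | .X 0 k => gen (.W k) 1
  | .X (i + 1) k => gen (.X i k) 1
  -- A correction for compatibility with the differential. Like the value on `.W k`, it has zero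
  -- augmentation and does not affect the induced map on cochains.
  | .Y 1 k => ev k (gen (.Y 0 k) (tau • sqA))
  | .Y _ _ => 0

/-- The chain map that lifts `h₁`. -/
def h1Gen : RMon → Res
  | .W k => genPred (.X 0) k (sqA * sqB)
  | .X _ _ => 0
  | .Y 0 k => gen (.W k) 1
  | .Y (j + 1) k => gen (.Y j k) 1

/-- The chain map that lifts `α`. -/
def alphaGen : RMon → Res
  -- The intended generator is y w^{k-2}; truncated subtraction makes the value zero for both `k =
  -- 0` and `k = 1`.
  | .W k => genPred (.Y 0) (k - 1) (sqB * sqA)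
  | .X 0 k => genPred .W k 1
  | .X (i + 1) k => genPred (.X i) k 1
  | .Y 1 (k + 1) => ev (k + 1) (gen (.Y 0 k) (tau • sqA))
  | .Y _ _ => 0

/-- The chain map that lifts `β`. -/
def betaGen : RMon → Res
  | .W (k + 2) => gen (.W k) 1
  | .X i (k + 2) => gen (.X i k) 1
  | .Y j (k + 2) => gen (.Y j k) 1
  | _ => 0

/-- The `A(1)`-linear chain maps of the resolution. -/
def IsChain (F : Res →ₗ[A1] Res) : Prop := ∀ z, diff (F z) = F (diff z)

theorem isChain_resLift {G : RMon → Res} (h : ∀ g, resLift diffGen (G g) = resLift G (diffGen g)) :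
    IsChain (resLift G) := fun z => by
  suffices diff ∘ₗ resLift G = resLift G ∘ₗ diff from LinearMap.congr_fun this z
  refine res_hom_ext fun g => ?_
  change resLift diffGen (resLift G (gen g 1)) = resLift G (resLift diffGen (gen g 1))
  rw [resLift_gen, resLift_gen, one_smul, one_smul, h]

theorem isChain_h0 : IsChain (resLift h0Gen) := isChain_resLift fun g => by
  rcases g with k | ⟨_ | _ | i, k⟩ | ⟨_ | _ | _ | _ | _ | j, k⟩ <;> revert k <;>
    refine even_cases ?_ ?_ ?_ ?_ ?_ <;> intros <;>
    simp only [*, diffGen, h0Gen, genPred, ev, res_rules, Nat.add_assoc, Nat.reduceAdd] <;>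
    simp only [res_add_rules]

theorem isChain_h1 : IsChain (resLift h1Gen) := isChain_resLift fun g => by
  rcases g with k | ⟨_ | _ | i, k⟩ | ⟨_ | _ | _ | _ | _ | j, k⟩ <;> revert k <;>
    refine even_cases ?_ ?_ ?_ ?_ ?_ <;> intros <;>
    simp only [*, diffGen, h1Gen, genPred, ev, res_rules, Nat.add_assoc, Nat.reduceAdd] <;>
    simp only [res_add_rules]

theorem isChain_alpha : IsChain (resLift alphaGen) := isChain_resLift fun g => by
  rcases g with k | ⟨_ | _ | i, k⟩ | ⟨_ | _ | _ | _ | _ | j, k⟩ <;> revert k <;>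
    refine even_cases ?_ ?_ ?_ ?_ ?_ <;> intros <;>
    simp only [*, diffGen, alphaGen, genPred, ev, res_rules, Nat.add_assoc, Nat.reduceAdd,
      Nat.add_one_sub_one, Nat.reduceSub, Nat.reduceSubDiff] <;>
    simp only [res_add_rules]

theorem isChain_beta : IsChain (resLift betaGen) := isChain_resLift fun g => by
  rcases g with k | ⟨_ | _ | i, k⟩ | ⟨_ | _ | _ | _ | _ | j, k⟩ <;> revert k <;>
    refine even_cases ?_ ?_ ?_ ?_ ?_ <;> intros <;>
    simp only [*, diffGen, betaGen, genPred, ev, res_rules, Nat.add_assoc, Nat.reduceAdd]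

/-! ### Exactness of the resolution. -/

/-- The contracting homotopy on the basis over `𝔽₂[τ]`. -/
def contrGen : RMon → Fin 8 → Res
  | .W k => ![0, gen (.X 0 k) 1, gen (.Y 0 k) 1, gen (.Y 0 k) sqA, gen (.X 0 k) sqB,
      gen (.X 0 k) (sqA * sqB), gen (.Y 0 k) (sqB * sqA), gen (.X 0 k) (sqB * (sqA * sqB))]
  | .X i k => ![0, gen (.X (i + 1) k) 1, 0, 0, gen (.X (i + 1) k) sqB, gen (.X (i + 1) k) (sqA * sqB),
      0, gen (.X (i + 1) k) (sqB * (sqA * sqB))]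
  | .Y 0 k => ![0, 0, gen (.Y 1 k) 1, gen (.Y 1 k) sqA, 0, gen (.W (k + 1)) 1,
      gen (.Y 1 k) (sqB * sqA), gen (.Y 1 k) (sqA * (sqB * sqA))]
  | .Y 1 k => ![0, 0, gen (.Y 2 k) 1, gen (.Y 2 k) sqA + ev k (gen (.X 0 (k + 1)) (tau • 1)), 0, 0,
      gen (.Y 2 k) (sqB * sqA) + ev k (gen (.X 0 (k + 1)) (tau • sqB)),
      gen (.Y 2 k) (sqA * (sqB * sqA)) + ev k (gen (.X 0 (k + 1)) (tau • (sqA * sqB)))]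
  | .Y 2 k => ![0, 0, gen (.Y 3 k) 1, gen (.Y 3 k) sqA, 0, 0, gen (.Y 3 k) (sqB * sqA),
      gen (.Y 3 k) (sqA * (sqB * sqA)) + ev k (gen (.W (k + 2)) (tau • 1))]
  | .Y (j + 3) k => ![0, 0, gen (.Y (j + 4) k) 1, gen (.Y (j + 4) k) sqA, 0, 0,
      gen (.Y (j + 4) k) (sqB * sqA), gen (.Y (j + 4) k) (sqA * (sqB * sqA))]

/-- The contracting homotopy. -/
def contr : Res →ₗ[M2] Res := Finsupp.lsum M2 fun g => a1Basis.constr M2 (contrGen g)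

theorem contr_gen_a1Mon (g : RMon) (i : Fin 8) : contr (gen g (a1Mon i)) = contrGen g i := by
  rw [contr, gen, Finsupp.lsum_single, ← a1Basis_apply, Module.Basis.constr_basis]

/-- Rewriting rules for the contracting homotopy. -/
theorem contr_rules :
    (∀ y z, contr (y + z) = contr y + contr z) ∧ contr 0 = 0 ∧
    (∀ g x, contr (gen g (tau • x)) = tau • contr (gen g x)) ∧
    (∀ g, contr (gen g 1) = contrGen g 0) ∧ (∀ g, contr (gen g sqA) = contrGen g 1) ∧
    (∀ g, contr (gen g sqB) = contrGen g 2) ∧ (∀ g, contr (gen g (sqA * sqB)) = contrGen g 3) ∧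
    (∀ g, contr (gen g (sqB * sqA)) = contrGen g 4) ∧
    (∀ g, contr (gen g (sqA * (sqB * sqA))) = contrGen g 5) ∧
    (∀ g, contr (gen g (sqB * (sqA * sqB))) = contrGen g 6) ∧
    (∀ g, contr (gen g (sqA * (sqB * (sqA * sqB)))) = contrGen g 7) ∧
    (∀ y z : Res, tau • (y + z) = tau • y + tau • z) ∧ tau • (0 : Res) = 0 ∧
    (∀ g x, tau • gen g x = gen g (tau • x)) :=
  ⟨map_add _, map_zero _, fun g x => by rw [gen_smul, map_smul], fun g => contr_gen_a1Mon g 0,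
    fun g => contr_gen_a1Mon g 1, fun g => contr_gen_a1Mon g 2, fun g => contr_gen_a1Mon g 3,
    fun g => contr_gen_a1Mon g 4, fun g => contr_gen_a1Mon g 5, fun g => contr_gen_a1Mon g 6,
    fun g => contr_gen_a1Mon g 7, smul_add _, smul_zero _, fun g x => (gen_smul g tau x).symm⟩

/-- The augmentation of the resolution, followed by the inclusion of `𝔽₂[τ]`. -/
def augInc : Res →ₗ[M2] Res :=
  Finsupp.lsingle (.W 0) ∘ₗ Algebra.linearMap M2 A1 ∘ₗ aug.toLinearMap ∘ₗ Finsupp.lapply (.W 0)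

theorem augInc_gen (x : A1) : augInc (gen (.W 0) x) = gen (.W 0) (algebraMap M2 A1 (aug x)) := by
  simp [augInc, gen]

theorem augInc_gen_of_ne {g : RMon} (h : g ≠ .W 0) (x : A1) : augInc (gen g x) = 0 := by
  simp [augInc, gen, h]

theorem augInc_rules :
   augInc (gen (.W 0) 1) = gen (.W 0) 1 ∧
   (∀ x, augInc (gen (.W 0) (sqA * x)) = 0) ∧ (∀ x, augInc (gen (.W 0) (sqB * x)) = 0) ∧
   augInc (gen (.W 0) sqA) = 0 ∧ augInc (gen (.W 0) sqB) = 0 ∧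
   (∀ k x, augInc (gen (.W (k + 1)) x) = 0) ∧ (∀ i k x, augInc (gen (.X i k) x) = 0) ∧
   (∀ j k x, augInc (gen (.Y j k) x) = 0) := by
  refine ⟨?_, ?_, ?_, ?_, ?_, fun _ _ => augInc_gen_of_ne (by simp) _,
    fun _ _ _ => augInc_gen_of_ne (by simp) _, fun _ _ _ => augInc_gen_of_ne (by simp) _⟩ <;>
    simp [augInc_gen, gen_zero]

set_option maxHeartbeats 4000000 in
-- All the maps are linear over 𝔽₂[τ], so the identity is checked on the products of a basis
-- monomial of `A(1)` with a generator. It yields exactness in every bidegree at once.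
theorem contr_identity (z : Res) : diff (contr z) + (contr (diff z) + augInc z) = z := by
  suffices diff.restrictScalars M2 ∘ₗ contr + (contr ∘ₗ diff.restrictScalars M2 + augInc) =
    LinearMap.id from LinearMap.congr_fun this z
  refine Finsupp.lhom_ext' fun g => a1Basis.ext fun e => ?_
  rw [a1Basis_apply]
  change resLift diffGen (contr (gen g (a1Mon e))) + (contr (resLift diffGen (gen g (a1Mon e))) +
    augInc (gen g (a1Mon e))) = gen g (a1Mon e)
  rw [contr_gen_a1Mon]
  rcases g with k | ⟨_ | i, k⟩ | ⟨_ | _ | _ | _ | _ | _ | j, k⟩ <;> revert k <;>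
    refine even_cases ?_ ?_ ?_ ?_ ?_ <;> intros <;> fin_cases e <;>
    simp only [*, diffGen, contrGen, a1Mon, Matrix.cons_val, Matrix.cons_val_zero,
      Matrix.cons_val_one, genPred, ev, res_rules, contr_rules, augInc_rules, Nat.add_assoc,
      Nat.reduceAdd, Fin.zero_eta, Fin.mk_one, Fin.reduceFinMk] <;>
    simp only [res_add_rules]

/-! ### Homogeneity of the differential, the chain maps and the homotopy. -/

/-- The part of the resolution of homological degree `n` and internal bidegree `d`. -/
def resGrad (n : ℤ) (d : ℤ × ℤ) : AddSubgroup Res where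
  carrier := {z | ∀ g, z g ∈ gradA1 (d - g.ideg) ∧ (g.hdeg ≠ n → z g = 0)}
  zero_mem' := fun g => ⟨zero_mem _, fun _ => rfl⟩
  add_mem' := fun {y z} hy hz g => ⟨by
    rw [Finsupp.add_apply]; exact add_mem (hy g).1 (hz g).1, fun h => by
    rw [Finsupp.add_apply, (hy g).2 h, (hz g).2 h, add_zero]⟩
  neg_mem' := fun {z} hz g => ⟨by
    rw [Finsupp.neg_apply]; exact neg_mem (hz g).1, fun h => by
    rw [Finsupp.neg_apply, (hz g).2 h, neg_zero]⟩

theorem gen_mem {g : RMon} {x : A1} {n : ℤ} {d e : ℤ × ℤ} (hx : x ∈ gradA1 e) (hn : g.hdeg = n)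
    (hd : e + g.ideg = d) : gen g x ∈ resGrad n d := fun g' => by
  by_cases h : g' = g
  · subst h
    rw [gen, Finsupp.single_eq_same]
    exact ⟨by rwa [← hd, add_sub_cancel_right], fun h => absurd hn h⟩
  · rw [gen, Finsupp.single_eq_of_ne h]
    exact ⟨zero_mem _, fun _ => rfl⟩

theorem smul_mem_resGrad {x : A1} {z : Res} {n : ℤ} {d e f : ℤ × ℤ} (hx : x ∈ gradA1 e)
    (hz : z ∈ resGrad n d) (h : e + d = f) : x • z ∈ resGrad n f := fun g =>
  ⟨by
    rw [Finsupp.smul_apply, smul_eq_mul]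
    exact mul_mem_gradA1 hx (hz g).1 (by rw [← h, add_sub_assoc]), fun hg => by
    rw [Finsupp.smul_apply, (hz g).2 hg, smul_zero]⟩

theorem m2_smul_mem_resGrad {p : M2} {z : Res} {n : ℤ} {d e f : ℤ × ℤ} (hp : p ∈ gradM2 e)
    (hz : z ∈ resGrad n d) (h : e + d = f) : p • z ∈ resGrad n f := fun g =>
  ⟨by
    rw [Finsupp.smul_apply]
    exact smul_mem_gradA1 hp (hz g).1 (by rw [← h, add_sub_assoc]), fun hg => by
    rw [Finsupp.smul_apply, (hz g).2 hg, smul_zero]⟩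

theorem sum_gen (z : Res) : z.sum gen = z := Finsupp.sum_single z

theorem map_mem_of_gen {M : Type*} [AddCommGroup M] {L : Res →+ M} {T : AddSubgroup M} {n : ℤ}
    {d : ℤ × ℤ} (h : ∀ g x, g.hdeg = n → x ∈ gradA1 (d - g.ideg) → L (gen g x) ∈ T) {z : Res}
    (hz : z ∈ resGrad n d) : L z ∈ T := by
  rw [← sum_gen z, Finsupp.sum, map_sum]
  exact sum_mem fun g hg => h g _
    (by by_contra h'; exact Finsupp.mem_support_iff.1 hg ((hz g).2 h')) (hz g).1

/-- The maps that lower the homological degree by `n` and the internal bidegree by `d`. -/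
def IsHomog (F : Res → Res) (n₀ : ℤ) (d₀ : ℤ × ℤ) : Prop :=
  ∀ n d z, z ∈ resGrad n d → F z ∈ resGrad (n - n₀) (d - d₀)

theorem isHomog_resLift {G : RMon → Res} {n₀ : ℤ} {d₀ : ℤ × ℤ}
    (h : ∀ g, G g ∈ resGrad (g.hdeg - n₀) (g.ideg - d₀)) : IsHomog (resLift G) n₀ d₀ := by
  intro n d z hz
  refine map_mem_of_gen (M := Res) (L := (resLift G).toAddMonoidHom) (fun g x hg hx => ?_) hz
  change resLift G (gen g x) ∈ _
  rw [resLift_gen]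
  exact smul_mem_resGrad hx (hg ▸ h g) (by abel)

theorem isHomog_contr_of_gen
    (h : ∀ g i, contrGen g i ∈ resGrad (g.hdeg - (-1)) (a1Deg i + g.ideg)) :
    IsHomog contr (-1) 0 := by
  intro n d z hz
  refine map_mem_of_gen (M := Res) (L := contr.toAddMonoidHom) (fun g x hg hx => ?_) hz
  change contr (gen g x) ∈ _
  have : gen g x = ∑ i, a1Coord x i • gen g (a1Mon i) := by
    simp_rw [← gen_smul]
    conv_lhs => rw [← sum_a1Coord x]
    exact map_sum (Finsupp.singleAddHom g) _ _
  rw [this, map_sum]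
  refine sum_mem fun i _ => ?_
  rw [map_smul, contr_gen_a1Mon]
  exact m2_smul_mem_resGrad (a1Coord_mem hx i) (hg ▸ h g i) (by abel)

theorem ev_mem {T : AddSubgroup Res} {z : Res} (h : z ∈ T) (k : ℕ) : ev k z ∈ T := by
  by_cases hk : Even k
  · rwa [ev_pos hk]
  · rw [ev_neg hk]; exact zero_mem _

theorem genPred_mem {T : AddSubgroup Res} {f : ℕ → RMon} {x : A1} {k : ℕ}
    (h : ∀ l, k = l + 1 → gen (f l) x ∈ T) : genPred f k x ∈ T := by
  cases k with
  | zero => exact zero_mem _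
  | succ k => exact h k rfl

theorem sqA_mul_sqB_mem : sqA * sqB ∈ gradA1 (3, 1) := a1Mon_mem 3
theorem sqB_mul_sqA_mem : sqB * sqA ∈ gradA1 (3, 1) := a1Mon_mem 4
theorem sqA_mul_sqB_mul_sqA_mem : sqA * (sqB * sqA) ∈ gradA1 (4, 1) := a1Mon_mem 5
theorem sqB_mul_sqA_mul_sqB_mem : sqB * (sqA * sqB) ∈ gradA1 (5, 2) := a1Mon_mem 6
theorem tau_smul_mem {x : A1} {d : ℤ × ℤ} (hx : x ∈ gradA1 d) :
    tau • x ∈ gradA1 ((0, 1) + d) := smul_mem_gradA1 tau_mem hx rfl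

theorem isHomog_diff : IsHomog diff 1 0 := isHomog_resLift fun g => by
  rcases g with k | ⟨_ | i, k⟩ | ⟨_ | _ | _ | j, k⟩ <;>
  repeat' first
    | exact zero_mem _
    | refine add_mem ?_ ?_
    | refine ev_mem ?_ _
    | (refine genPred_mem ?_; rintro l hl)
    | refine gen_mem sqA_mem ?_ ?_
    | refine gen_mem sqB_mem ?_ ?_
    | refine gen_mem sqA_mul_sqB_mul_sqA_mem ?_ ?_
    | refine gen_mem sqB_mul_sqA_mul_sqB_mem ?_ ?_
    | refine gen_mem (tau_smul_mem sqA_mul_sqB_mem) ?_ ?_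
    | refine gen_mem (tau_smul_mem one_mem_gradA1) ?_ ?_
    | (simp only [RMon.hdeg]; push_cast; omega)
    | (ext <;> simp [RMon.ideg] <;> omega)

theorem isHomog_h0 : IsHomog (resLift h0Gen) 1 (1, 0) := isHomog_resLift fun g => by
  rcases g with k | ⟨_ | i, k⟩ | ⟨_ | _ | j, k⟩ <;>
  repeat' first
    | exact zero_mem _
    | refine add_mem ?_ ?_
    | refine ev_mem ?_ _
    | (refine genPred_mem ?_; rintro l hl)
    | refine gen_mem one_mem_gradA1 ?_ ?_
    | refine gen_mem sqB_mul_sqA_mem ?_ ?_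
    | refine gen_mem (tau_smul_mem sqA_mem) ?_ ?_
    | (simp only [RMon.hdeg]; push_cast; omega)
    | (ext <;> simp [RMon.ideg] <;> omega)

theorem isHomog_h1 : IsHomog (resLift h1Gen) 1 (2, 1) := isHomog_resLift fun g => by
  rcases g with k | ⟨_ | i, k⟩ | ⟨_ | j, k⟩ <;>
  repeat' first
    | exact zero_mem _
    | refine add_mem ?_ ?_
    | refine ev_mem ?_ _
    | (refine genPred_mem ?_; rintro l hl)
    | refine gen_mem one_mem_gradA1 ?_ ?_
    | refine gen_mem sqA_mul_sqB_mem ?_ ?_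
    | (simp only [RMon.hdeg]; push_cast; omega)
    | (ext <;> simp [RMon.ideg] <;> omega)

theorem isHomog_alpha : IsHomog (resLift alphaGen) 3 (7, 2) := isHomog_resLift fun g => by
  rcases g with k | ⟨_ | i, k⟩ | ⟨_ | _ | j, _ | k⟩ <;>
  repeat' first
    | exact zero_mem _
    | refine add_mem ?_ ?_
    | refine ev_mem ?_ _
    | (refine genPred_mem ?_; rintro l hl)
    | refine gen_mem one_mem_gradA1 ?_ ?_
    | refine gen_mem sqB_mul_sqA_mem ?_ ?_
    | refine gen_mem (tau_smul_mem sqA_mem) ?_ ?_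
    | (simp only [RMon.hdeg]; push_cast; omega)
    | (ext <;> simp [RMon.ideg] <;> omega)

theorem isHomog_beta : IsHomog (resLift betaGen) 4 (12, 4) := isHomog_resLift fun g => by
  rcases g with (_ | _ | k) | ⟨i, _ | _ | k⟩ | ⟨j, _ | _ | k⟩ <;>
  repeat' first
    | exact zero_mem _
    | refine add_mem ?_ ?_
    | refine ev_mem ?_ _
    | refine gen_mem one_mem_gradA1 ?_ ?_
    | (simp only [RMon.hdeg]; push_cast; omega)
    | (ext <;> simp [RMon.ideg] <;> omega)

theorem isHomog_contr : IsHomog contr (-1) 0 := isHomog_contr_of_gen fun g e => by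
  rcases g with k | ⟨i, k⟩ | ⟨_ | _ | _ | j, k⟩ <;> fin_cases e <;>
  simp only [contrGen, Matrix.cons_val, Matrix.cons_val_zero, Matrix.cons_val_one, Fin.zero_eta,
    Fin.mk_one, Fin.reduceFinMk] <;>
  repeat' first
    | exact zero_mem _
    | refine add_mem ?_ ?_
    | refine ev_mem ?_ _
    | refine gen_mem one_mem_gradA1 ?_ ?_
    | refine gen_mem sqA_mem ?_ ?_
    | refine gen_mem sqB_mem ?_ ?_
    | refine gen_mem sqA_mul_sqB_mem ?_ ?_
    | refine gen_mem sqB_mul_sqA_mem ?_ ?_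
    | refine gen_mem sqB_mul_sqA_mul_sqB_mem ?_ ?_
    | refine gen_mem sqA_mul_sqB_mul_sqA_mem ?_ ?_
    | refine gen_mem (tau_smul_mem one_mem_gradA1) ?_ ?_
    | refine gen_mem (tau_smul_mem sqB_mem) ?_ ?_
    | refine gen_mem (tau_smul_mem sqA_mul_sqB_mem) ?_ ?_
    | (simp only [RMon.hdeg]; push_cast; omega)
    | (ext <;> simp [RMon.ideg, a1Deg] <;> omega)

/-! ### The resolution in the category of bigraded modules -/

section

variable {ι A : Type} [AddCommGroup ι] [Ring A] (𝒜 : ι → AddSubgroup A)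
  [SetLike.GradedMonoid 𝒜]

/-- The inclusion of graded modules into all functors is exact and faithful, and exactness of
functors to abelian groups is tested degree by degree. -/
theorem gradedMod_shortExact (S : ShortComplex (GradedMod 𝒜))
    (hf : ∀ i, Function.Injective (S.f.hom.app i)) (hg : ∀ i, Function.Surjective (S.g.hom.app i))
    (h : ∀ i x, S.g.hom.app i x = 0 → ∃ y, S.f.hom.app i y = x) : S.ShortExact := by
  have ex : S.Exact := by
    rw [← ShortComplex.exact_map_iff_of_faithful S (isGradedModule 𝒜).ι,
      ShortComplex.exact_iff_isZero_homology, Functor.isZero_iff]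
    intro i
    refine IsZero.of_iso ?_ ((S.map (isGradedModule 𝒜).ι).mapHomologyIso
      ((evaluation (DegreeCat 𝒜) AddCommGrpCat.{0}).obj i)).symm
    rw [← ShortComplex.exact_iff_isZero_homology, ShortComplex.ab_exact_iff]
    exact h i
  have m : Mono S.f := by
    refine (isGradedModule 𝒜).ι.mono_of_mono_map ?_
    have (i : DegreeCat 𝒜) : Mono (S.f.hom.app i) := (AddCommGrpCat.mono_iff_injective _).2 (hf i)
    exact NatTrans.mono_of_mono_app S.f.hom
  have e : Epi S.g := by
    refine (isGradedModule 𝒜).ι.epi_of_epi_map ?_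
    have (i : DegreeCat 𝒜) : Epi (S.g.hom.app i) := (AddCommGrpCat.epi_iff_surjective _).2 (hg i)
    exact NatTrans.epi_of_epi_app S.g.hom
  exact { exact := ex, mono_f := m, epi_g := e }

theorem gradedMod_surjective {X Y : GradedMod 𝒜} (f : X ⟶ Y) [Epi f] (i : DegreeCat 𝒜) :
    Function.Surjective (f.hom.app i) := by
  have : Epi f.hom := inferInstanceAs (Epi ((isGradedModule 𝒜).ι.map f))
  exact (AddCommGrpCat.epi_iff_surjective _).1 inferInstance

end

/-! ### Cochains -/

/-- The `A(1)`-linear map from the resolution to `𝔽₂[τ]` with given values on the generators. -/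
def pairing (c : RMon → M2) : Res →ₗ[M2] M2 :=
  Finsupp.lsum M2 fun g => LinearMap.mulRight M2 (c g) ∘ₗ aug.toLinearMap

theorem pairing_gen (c : RMon → M2) (g : RMon) (x : A1) : pairing c (gen g x) = aug x * c g := by
  simp [pairing, gen]

theorem pairing_smul (c : RMon → M2) (x : A1) (z : Res) :
    pairing c (x • z) = aug x * pairing c z := by
  induction z using Finsupp.induction_linear with
  | zero => rw [smul_zero, map_zero, mul_zero]
  | add y z hy hz => rw [smul_add, map_add, map_add, hy, hz, mul_add]
  | single g y =>
    change pairing c (x • gen g y) = aug x * pairing c (gen g y)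
    rw [smul_gen, pairing_gen, pairing_gen, map_mul, mul_assoc]

theorem pairing_resLift (c : RMon → M2) (G : RMon → Res) (z : Res) :
    pairing c (resLift G z) = pairing (fun g => pairing c (G g)) z := by
  induction z using Finsupp.induction_linear with
  | zero => rw [map_zero, map_zero, map_zero]
  | add y z hy hz => rw [map_add, map_add, map_add, hy, hz]
  | single g y =>
    change pairing c (resLift G (gen g y)) = pairing _ (gen g y)
    rw [resLift_gen, pairing_smul, pairing_gen]

theorem pairing_zero_left (z : Res) : pairing (fun _ => 0) z = 0 := by
  rw [← sum_gen z, Finsupp.sum, map_sum]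
  exact Finset.sum_eq_zero fun g _ => by rw [pairing_gen, mul_zero]

theorem pairing_add (c c' : RMon → M2) (z : Res) :
    pairing (c + c') z = pairing c z + pairing c' z := by
  rw [← sum_gen z, Finsupp.sum, map_sum, map_sum, map_sum, ← Finset.sum_add_distrib]
  exact Finset.sum_congr rfl fun g _ => by
    rw [pairing_gen, pairing_gen, pairing_gen, Pi.add_apply, mul_add]

/-- The cochains of homological degree `n` and internal bidegree `d`. -/
def IsCochain (n : ℤ) (d : ℤ × ℤ) (c : RMon → M2) : Prop :=
  ∀ g : RMon, c g ∈ gradM2 (g.ideg - d) ∧ (g.hdeg ≠ n → c g = 0)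

theorem pairing_mem {c : RMon → M2} {n : ℤ} {d e : ℤ × ℤ} (hc : IsCochain n d c) {z : Res}
    (hz : z ∈ resGrad n e) : pairing c z ∈ gradM2 (e - d) := by
  refine map_mem_of_gen (M := M2) (L := (pairing c).toAddMonoidHom) (fun g x hg hx => ?_) hz
  change pairing c (gen g x) ∈ _
  rw [pairing_gen]
  exact mul_mem_gradM2 (augmentation_mem hx) (hc g).1 (by abel)

/-- The augmentation of the resolution, as a cochain. -/
def epsCochain : RMon → M2
  | .W 0 => 1
  | _ => 0

theorem isCochain_eps : IsCochain 0 0 epsCochain := fun g => by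
  rcases g with (_ | k) | ⟨i, k⟩ | ⟨j, k⟩
  · refine ⟨?_, fun h => absurd rfl h⟩
    exact (SetLike.GradedOne.one_mem : (1 : M2) ∈ gradM2 0)
  all_goals exact ⟨zero_mem _, fun _ => rfl⟩

theorem pairing_eps (z : Res) : pairing epsCochain z = aug (z (.W 0)) := by
  induction z using Finsupp.induction_linear with
  | zero => rw [map_zero, Finsupp.zero_apply, map_zero]
  | add y z hy hz => rw [map_add, hy, hz, Finsupp.add_apply, map_add]
  | single g y =>
    change pairing epsCochain (gen g y) = _
    rw [pairing_gen]
    rcases g with (_ | k) | ⟨i, k⟩ | ⟨j, k⟩ <;> simp [epsCochain]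

theorem pairing_ev (c : RMon → M2) (k : ℕ) (z : Res) :
    pairing c (ev k z) = if Even k then pairing c z else 0 := by
  split_ifs with h
  · rw [ev_pos h]
  · rw [ev_neg h, map_zero]

theorem pairing_genPred (c : RMon → M2) (f : ℕ → RMon) (k : ℕ) (x : A1) (hx : aug x = 0) :
    pairing c (genPred f k x) = 0 := by
  cases k with
  | zero => exact map_zero _
  | succ k => rw [genPred, pairing_gen, hx, zero_mul]

/-- The coboundary of a cochain. -/
def cobd (c : RMon → M2) : RMon → M2
  | .Y 2 k => if Even k then tau * c (.W (k + 1)) else 0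
  | .Y (j + 3) k => if Even k then tau * c (.Y j (k + 1)) else 0
  | _ => 0

/-- Every coefficient of the differential lies in the augmentation ideal except the τ·1. So the
cochain complex is 𝔽₂[τ][x, y, w]/(xy) with d w = τ y³. -/
theorem pairing_diffGen (c : RMon → M2) (g : RMon) : pairing c (diffGen g) = cobd c g := by
  rcases g with k | ⟨_ | i, k⟩ | ⟨_ | _ | _ | j, k⟩ <;>
    simp [diffGen, pairing_gen, pairing_ev, pairing_genPred, cobd]

theorem pairing_diff (c : RMon → M2) (z : Res) : pairing c (diff z) = pairing (cobd c) z := by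
  rw [diff, pairing_resLift]
  exact congrArg (pairing · z) (funext (pairing_diffGen c))

theorem cobd_eps : cobd epsCochain = fun _ => 0 := by
  funext g
  rcases g with k | ⟨i, k⟩ | ⟨_ | _ | _ | j, k⟩ <;> simp [cobd, epsCochain]

theorem augInc_eq_zero {z : Res} (h : pairing epsCochain z = 0) : augInc z = 0 := by
  rw [pairing_eps] at h
  simp [augInc, h]

/-! ### The resolution -/

/-- The graded module given by a family of subgroups of the resolution. -/
def resMod (Γ : ℤ × ℤ → AddSubgroup Res)
    (h : ∀ {d e f : ℤ × ℤ} {x : A1} {z : Res}, x ∈ gradA1 d → z ∈ Γ e → d + e = f → x • z ∈ Γ f) :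
    GradedMod gradA1 where
  obj :=
    { obj := fun i => AddCommGrpCat.of (Γ i.deg)
      map := fun x => AddCommGrpCat.ofHom
        (AddMonoidHom.mk' (fun m => ⟨x.1 • m.1, h x.2 m.2 (sub_add_cancel _ _)⟩)
          fun _ _ => Subtype.ext (smul_add _ _ _))
      map_id := fun _ =>
        AddCommGrpCat.hom_ext (AddMonoidHom.ext fun m => Subtype.ext (one_smul A1 m.1))
      map_comp := fun x y =>
        AddCommGrpCat.hom_ext (AddMonoidHom.ext fun m => Subtype.ext (mul_smul y.1 x.1 m.1)) }
  property := ⟨fun {_ _ x y} =>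
    AddCommGrpCat.hom_ext (AddMonoidHom.ext fun m => Subtype.ext (add_smul x.1 y.1 m.1))⟩

/-- The free module of homological degree `n`. -/
def resP (n : ℕ) : GradedMod gradA1 := resMod (resGrad n) smul_mem_resGrad

/-- The cycles of homological degree `n`. -/
def cycGrad (n : ℕ) (d : ℤ × ℤ) : AddSubgroup Res :=
  -- The condition on `diff` is automatic in degree 0, and the one on the augmentation in positive
  -- degrees. Imposing both treats all degrees uniformly.
  resGrad n d ⊓ (diff.toAddMonoidHom.ker ⊓ (pairing epsCochain).toAddMonoidHom.ker)

theorem mem_cycGrad {n : ℕ} {d : ℤ × ℤ} {z : Res} :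
    z ∈ cycGrad n d ↔ z ∈ resGrad n d ∧ diff z = 0 ∧ pairing epsCochain z = 0 := Iff.rfl

theorem IsHomog.mem {F : Res → Res} {n n₀ n' : ℤ} {d d₀ d' : ℤ × ℤ} (hF : IsHomog F n₀ d₀) {z : Res}
    (hz : z ∈ resGrad n d) (hn : n - n₀ = n') (hd : d - d₀ = d') : F z ∈ resGrad n' d' := by
  subst hn hd
  exact hF _ _ _ hz

theorem diff_mem_cycGrad {n : ℕ} {d : ℤ × ℤ} {z : Res} (hz : z ∈ resGrad (n + 1 : ℕ) d) :
    diff z ∈ cycGrad n d :=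
  mem_cycGrad.2 ⟨isHomog_diff.mem hz (by simp) (sub_zero d), diff_diff z, by
    rw [pairing_diff, cobd_eps, pairing_zero_left]⟩

/-- On a cycle of zero augmentation the homotopy identity reads `diff (contr z) = z`. -/
theorem exists_diff_eq {n : ℕ} {d : ℤ × ℤ} {z : Res} (hz : z ∈ cycGrad n d) :
    ∃ y ∈ resGrad (n + 1 : ℕ) d, diff y = z := by
  obtain ⟨h1, h2, h3⟩ := mem_cycGrad.1 hz
  refine ⟨contr z, isHomog_contr.mem h1 (by simp) (sub_zero d), ?_⟩
  have := contr_identity z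
  rwa [h2, map_zero, augInc_eq_zero h3, add_zero, add_zero] at this

/-- The module of cycles of homological degree `n`. -/
def resZ (n : ℕ) : GradedMod gradA1 := resMod (cycGrad n) fun {_ _ _ x z} hx hz h => by
  rw [mem_cycGrad] at hz ⊢
  exact ⟨smul_mem_resGrad hx hz.1 h, by rw [map_smul, hz.2.1, smul_zero],
    by rw [pairing_smul, hz.2.2, mul_zero]⟩

/-- The syzygies. -/
def resK : ℕ → GradedMod gradA1
  | 0 => unitModule
  | n + 1 => resZ n

/-- The inclusion of the cycles. -/
def resI (n : ℕ) : resZ n ⟶ resP n :=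
  ObjectProperty.homMk
    { app := fun _ => AddCommGrpCat.ofHom (AddMonoidHom.mk'
        (fun m => ⟨m.1, (mem_cycGrad.1 m.2).1⟩) fun _ _ => rfl)
      naturality := fun _ _ _ => rfl }

/-- The differential, as a map to the cycles. -/
def resBd (n : ℕ) : resP (n + 1) ⟶ resZ n :=
  ObjectProperty.homMk
    { app := fun _ => AddCommGrpCat.ofHom (AddMonoidHom.mk'
        (fun m => ⟨diff m.1, diff_mem_cycGrad m.2⟩) fun _ _ => Subtype.ext (map_add diff _ _))
      naturality := fun _ _ x => AddCommGrpCat.hom_ext (AddMonoidHom.ext fun m =>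
        Subtype.ext (map_smul diff x.1 m.1)) }

/-- The augmentation. -/
def resAug : resP 0 ⟶ unitModule :=
  ObjectProperty.homMk
    { app := fun _ => AddCommGrpCat.ofHom (AddMonoidHom.mk'
        (fun m => ⟨pairing epsCochain m.1, by
          have := pairing_mem isCochain_eps m.2
          rwa [sub_zero] at this⟩)
          fun _ _ => Subtype.ext (map_add (pairing epsCochain) _ _))
      naturality := fun _ _ x => AddCommGrpCat.hom_ext (AddMonoidHom.ext fun m =>
        Subtype.ext (pairing_smul epsCochain x.1 m.1)) }

/-- The maps from the free modules to the syzygies. -/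
def resπ : ∀ n, resP n ⟶ resK n
  | 0 => resAug
  | n + 1 => resBd n

theorem resI_resπ : ∀ n, (resI n : resK (n + 1) ⟶ resP n) ≫ resπ n = 0
  | 0 => ObjectProperty.hom_ext _ <| NatTrans.ext <| funext fun _ => AddCommGrpCat.hom_ext <|
      AddMonoidHom.ext fun m => Subtype.ext (mem_cycGrad.1 m.2).2.2
  | _ + 1 => ObjectProperty.hom_ext _ <| NatTrans.ext <| funext fun _ => AddCommGrpCat.hom_ext <|
      AddMonoidHom.ext fun m => Subtype.ext (mem_cycGrad.1 m.2).2.1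

theorem diff_eq_zero_of_mem {d : ℤ × ℤ} {z : Res} (hz : z ∈ resGrad (0 : ℕ) d) : diff z = 0 := by
  ext g : 1
  refine (isHomog_diff.mem hz rfl rfl g).2 ?_
  rcases g with k | ⟨i, k⟩ | ⟨j, k⟩ <;> simp only [RMon.hdeg] <;> omega

theorem resSES : ∀ n, (ShortComplex.mk (resI n : resK (n + 1) ⟶ resP n) (resπ n)
    (resI_resπ n)).ShortExact
  | 0 => by
    refine gradedMod_shortExact _ _ (fun i x y h => ?_) (fun i x => ?_) (fun i x hx => ?_)
    · have h' := congrArg Subtype.val h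
      exact Subtype.ext h'
    · refine ⟨⟨gen (.W 0) (algebraMap M2 A1 x.1), ?_⟩, Subtype.ext ?_⟩
      · rw [Algebra.algebraMap_eq_smul_one]
        refine gen_mem (smul_mem_gradA1 x.2 one_mem_gradA1 rfl) rfl ?_
        rw [show RMon.ideg (.W 0) = 0 from rfl, show ((0 : ℤ), (0 : ℤ)) = 0 from rfl, add_zero,
          add_zero]
      · change pairing epsCochain (gen (.W 0) _) = x.1
        rw [pairing_gen]
        simp [epsCochain]
    · have h0 : pairing epsCochain x.1 = 0 := congrArg Subtype.val hx
      exact ⟨⟨x.1, mem_cycGrad.2 ⟨x.2, diff_eq_zero_of_mem x.2, h0⟩⟩, rfl⟩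
  | n + 1 => by
    refine gradedMod_shortExact _ _ (fun i x y h => ?_) (fun i x => ?_) (fun i x hx => ?_)
    · have h' := congrArg Subtype.val h
      exact Subtype.ext h'
    · obtain ⟨y, hy, hyx⟩ := exists_diff_eq x.2
      exact ⟨⟨y, hy⟩, Subtype.ext hyx⟩
    · have h0 : diff x.1 = 0 := congrArg Subtype.val hx
      refine ⟨⟨x.1, mem_cycGrad.2 ⟨x.2, h0, ?_⟩⟩, rfl⟩
      rw [pairing_eps, (x.2 (.W 0)).2 (by simp only [RMon.hdeg]; push_cast; omega), map_zero]

theorem finite_hdeg_eq (n : ℕ) : {g : RMon | g.hdeg = n}.Finite := by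
  refine ((((Set.finite_Iic n).image RMon.W).union
    (Set.Finite.image2 RMon.X (Set.finite_Iic n) (Set.finite_Iic n))).union
    (Set.Finite.image2 RMon.Y (Set.finite_Iic n) (Set.finite_Iic n))).subset fun g hg => ?_
  rcases g with k | ⟨i, k⟩ | ⟨j, k⟩ <;> simp only [RMon.hdeg, Set.mem_ofPred_eq] at hg
  · exact .inl (.inl ⟨k, Set.mem_Iic.2 (by omega), rfl⟩)
  · exact .inl (.inr ⟨i, Set.mem_Iic.2 (by omega), k, Set.mem_Iic.2 (by omega), rfl⟩)
  · exact .inr ⟨j, Set.mem_Iic.2 (by omega), k, Set.mem_Iic.2 (by omega), rfl⟩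

/-- The monomials of homological degree `n`. -/
def monos (n : ℕ) : Finset RMon := (finite_hdeg_eq n).toFinset

theorem mem_monos {n : ℕ} {g : RMon} : g ∈ monos n ↔ g.hdeg = n := by simp [monos]

theorem sum_monos {n : ℕ} {d : ℤ × ℤ} {z : Res} (hz : z ∈ resGrad n d) :
    ∑ g ∈ monos n, gen g (z g) = z := by
  conv_rhs => rw [← sum_gen z]
  refine (Finset.sum_subset (fun g hg => ?_) fun g _ hg => ?_).symm
  · rw [mem_monos]
    by_contra h
    exact Finsupp.mem_support_iff.1 hg ((hz g).2 h)
  · rw [Finsupp.notMem_support_iff.1 hg, gen_zero]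

/-! ### Freeness and projectivity of the terms of the resolution. -/

/-- A generator of the free module of homological degree `n`. -/
def resGen (n : ℕ) (g : RMon) (hg : g.hdeg = n) : (resP n).obj.obj ⟨g.ideg⟩ :=
  (⟨gen g 1, gen_mem one_mem_gradA1 hg (zero_add _)⟩ : resGrad n g.ideg)

/-- A coefficient of an element of the free module of homological degree `n`. -/
def resCoeff (n : ℕ) {i : DegreeCat gradA1} (z : (resP n).obj.obj i) (g : RMon) :
    (⟨g.ideg⟩ : DegreeCat gradA1) ⟶ i :=
  homOfMem gradA1 (z.1 g) (z.2 g).1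

/-- The inclusion of a component of a free module. -/
def resVal (n : ℕ) (i : DegreeCat gradA1) : (resP n).obj.obj i →+ Res :=
  (resGrad n i.deg).subtype

theorem resP_eq_sum (n : ℕ) {i : DegreeCat gradA1} (z : (resP n).obj.obj i) :
    z = ∑ g : {g // g ∈ monos n},
      (resP n).obj.map (resCoeff n z g.1) (resGen n g.1 (mem_monos.1 g.2)) := by
  refine Subtype.ext ((sum_monos z.2).symm.trans ?_)
  refine Eq.trans ?_ (map_sum (resVal n i) _ _).symm
  rw [← Finset.sum_coe_sort]
  refine Finset.sum_congr rfl fun g _ => ?_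
  change gen g.1 (z.1 g.1) = z.1 g.1 • gen g.1 1
  rw [smul_gen, mul_one]

theorem resP_hom_apply {n : ℕ} {X : GradedMod gradA1} (f : resP n ⟶ X) {i : DegreeCat gradA1}
    (z : (resP n).obj.obj i) :
    f.hom.app i z = ∑ g : {g // g ∈ monos n},
      X.obj.map (resCoeff n z g.1) (f.hom.app _ (resGen n g.1 (mem_monos.1 g.2))) := by
  conv_lhs => rw [resP_eq_sum n z]
  rw [map_sum]
  refine Finset.sum_congr rfl fun g _ => ?_
  exact ConcreteCategory.congr_hom (f.hom.naturality (resCoeff n z g.1)) _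

theorem resP_hom_ext {n : ℕ} {X : GradedMod gradA1} {f f' : resP n ⟶ X}
    (h : ∀ g hg, f.hom.app _ (resGen n g hg) = f'.hom.app _ (resGen n g hg)) : f = f' := by
  refine ObjectProperty.hom_ext _ (NatTrans.ext (funext fun i => ?_))
  ext z
  rw [resP_hom_apply, resP_hom_apply]
  exact Finset.sum_congr rfl fun g _ => by rw [h]

/-- The map from a free module with given values on the generators. -/
def resPLift (n : ℕ) (X : GradedMod gradA1) (t : ∀ g : RMon, X.obj.obj ⟨g.ideg⟩) : resP n ⟶ X :=
  ObjectProperty.homMk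
    { app := fun i => AddCommGrpCat.ofHom (AddMonoidHom.mk'
        (fun z => ∑ g : {g // g ∈ monos n}, X.obj.map (resCoeff n z g.1) (t g.1))
        fun y z => by
          rw [← Finset.sum_add_distrib]
          refine Finset.sum_congr rfl fun g _ => ?_
          have : resCoeff n (y + z) g.1 = resCoeff n y g.1 + resCoeff n z g.1 := rfl
          rw [this, Functor.map_add]
          rfl)
      naturality := fun i j x => by
        ext z
        change ∑ g : {g // g ∈ monos n}, X.obj.map (resCoeff n ((resP n).obj.map x z) g.1) (t g.1) =
          X.obj.map x (∑ g : {g // g ∈ monos n}, X.obj.map (resCoeff n z g.1) (t g.1))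
        rw [map_sum]
        refine Finset.sum_congr rfl fun g _ => ?_
        have : resCoeff n ((resP n).obj.map x z) g.1 = resCoeff n z g.1 ≫ x := rfl
        rw [this, Functor.map_comp]
        rfl }

theorem resPLift_gen (n : ℕ) (X : GradedMod gradA1) (t : ∀ g : RMon, X.obj.obj ⟨g.ideg⟩)
    (g : RMon) (hg : g.hdeg = n) : (resPLift n X t).hom.app _ (resGen n g hg) = t g := by
  change ∑ g' : {g // g ∈ monos n}, X.obj.map (resCoeff n (resGen n g hg) g'.1) (t g'.1) = t g
  rw [Finset.sum_eq_single ⟨g, mem_monos.2 hg⟩]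
  · have : resCoeff n (resGen n g hg) g = 𝟙 _ := Subtype.ext Finsupp.single_eq_same
    rw [this, X.obj.map_id]
    rfl
  · intro g' _ hg'
    have : resCoeff n (resGen n g hg) g'.1 = 0 :=
      Subtype.ext (Finsupp.single_eq_of_ne fun h => hg' (Subtype.ext h))
    rw [this, Functor.map_zero]
    rfl
  · exact fun h => absurd (Finset.mem_univ _) h

instance (n : ℕ) : Projective (resP n) where
  factors {E X} f e _ := by
    choose t ht using fun (g : RMon) (hg : g.hdeg = n) =>
      gradedMod_surjective gradA1 e ⟨g.ideg⟩ (f.hom.app _ (resGen n g hg))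
    classical
    refine ⟨resPLift n E fun g => if hg : g.hdeg = n then t g hg else 0,
      resP_hom_ext fun g hg => ?_⟩
    change e.hom.app _ ((resPLift n E _).hom.app _ (resGen n g hg)) = _
    rw [resPLift_gen, dif_pos hg, ht]

/-- The resolution of `𝔽₂[τ]` over `A(1)`. -/
def resTower : SyzygyTower (GradedMod gradA1) where
  K := resK
  P := resP
  i := resI
  π := resπ
  w := resI_resπ
  exact := resSES
  projective := inferInstance

/-! ### The `Ext` groups -/

theorem pairing_eq_zero {c : RMon → M2} {n n' : ℤ} {d e : ℤ × ℤ} (hc : IsCochain n d c) {z : Res}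
    (hz : z ∈ resGrad n' e) (h : n' ≠ n) : pairing c z = 0 := by
  refine map_mem_of_gen (M := M2) (L := (pairing c).toAddMonoidHom) (T := ⊥) (fun g x hg _ => ?_) hz
  change pairing c (gen g x) = 0
  rw [pairing_gen, (hc g).2 (hg ▸ h), mul_zero]

/-- The map from a free module given by a cochain. -/
def coHom (n : ℕ) (d : ℤ × ℤ) (c : RMon → M2) (hc : IsCochain n d c) :
    resP n ⟶ (susp gradA1 d).obj unitModule :=
  ObjectProperty.homMk
    { app := fun _ => AddCommGrpCat.ofHom (AddMonoidHom.mk'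
        (fun m => (⟨pairing c m.1, pairing_mem hc m.2⟩ : gradM2 _))
          fun _ _ => Subtype.ext (map_add (pairing c) _ _))
      naturality := fun _ _ x => AddCommGrpCat.hom_ext (AddMonoidHom.ext fun m =>
        Subtype.ext (pairing_smul c x.1 m.1)) }

theorem coHom_resGen (n : ℕ) (d : ℤ × ℤ) (c : RMon → M2) (hc : IsCochain n d c) (g : RMon)
    (hg : g.hdeg = n) :
    ((coHom n d c hc).hom.app ⟨g.ideg⟩ (resGen n g hg) : gradM2 (g.ideg - d)).1 = c g := by
  change pairing c (gen g 1) = c g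
  rw [pairing_gen, map_one, one_mul]

theorem exists_coHom {n : ℕ} {d : ℤ × ℤ} (f : resP n ⟶ (susp gradA1 d).obj unitModule) :
    ∃ c hc, coHom n d c hc = f := by
  let c : RMon → M2 := fun g =>
    if hg : g.hdeg = n then (f.hom.app _ (resGen n g hg) : gradM2 (g.ideg - d)).1 else 0
  have hc : IsCochain n d c := fun g => by
    by_cases hg : g.hdeg = n
    · have : c g = (f.hom.app _ (resGen n g hg) : gradM2 (g.ideg - d)).1 := dif_pos hg
      exact ⟨this ▸ Subtype.property _, fun h => absurd hg h⟩
    · have : c g = 0 := dif_neg hg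
      exact ⟨this ▸ zero_mem _, fun _ => this⟩
  refine ⟨c, hc, resP_hom_ext fun g hg => Subtype.ext ?_⟩
  exact (coHom_resGen n d c hc g hg).trans (dif_pos hg)

/-- The cocycles of homological degree `n` and internal bidegree `d`. -/
def IsCocycle (n : ℕ) (d : ℤ × ℤ) (c : RMon → M2) : Prop :=
  IsCochain n d c ∧ cobd c = fun _ => 0

theorem pairing_eq_zero_of_mem {n : ℕ} {d e : ℤ × ℤ} {c : RMon → M2} (hc : IsCocycle n d c)
    {z : Res} (hz : z ∈ cycGrad n e) : pairing c z = 0 := by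
  obtain ⟨y, -, hy⟩ := exists_diff_eq hz
  rw [← hy, pairing_diff, hc.2, pairing_zero_left]

theorem resI_coHom {n : ℕ} {d : ℤ × ℤ} {c : RMon → M2} (hc : IsCocycle n d c) :
    resI n ≫ coHom n d c hc.1 = 0 := by
  refine ObjectProperty.hom_ext _ (NatTrans.ext (funext fun i => AddCommGrpCat.hom_ext
    (AddMonoidHom.ext fun z => Subtype.ext ?_)))
  exact pairing_eq_zero_of_mem hc z.2

/-- The value of the coboundary at a generator is the value of the cochain on the boundary of that
generator, which is a cycle. -/
theorem cobd_eq_zero {n : ℕ} {d : ℤ × ℤ} {c : RMon → M2} (hc : IsCochain n d c)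
    (h : resI n ≫ coHom n d c hc = 0) : cobd c = fun _ => 0 := by
  funext g
  have hg : gen g 1 ∈ resGrad g.hdeg g.ideg := gen_mem one_mem_gradA1 rfl (zero_add _)
  have e : cobd c g = pairing c (diff (gen g 1)) := by
    rw [pairing_diff, pairing_gen, map_one, one_mul]
  by_cases hn : g.hdeg = (n + 1 : ℕ)
  · rw [hn] at hg
    have := ConcreteCategory.congr_hom (congrArg (fun f => f.hom.app ⟨g.ideg⟩) h)
      (⟨diff (gen g 1), diff_mem_cycGrad hg⟩ : cycGrad n g.ideg)
    exact e.trans (congrArg Subtype.val this)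
  · rw [e]
    exact pairing_eq_zero hc (isHomog_diff.mem hg rfl rfl) (by push_cast at hn; omega)

/-- The class of a cocycle. -/
def theta (n : ℕ) (d : ℤ × ℤ) (c : RMon → M2) (hc : IsCocycle n d c) :
    GExt gradA1 unitModule unitModule (n, d) :=
  resTower.cls n (coHom n d c hc.1) (resI_coHom hc)

theorem exists_theta {n : ℕ} {d : ℤ × ℤ} (y : GExt gradA1 unitModule unitModule (n, d)) :
    ∃ c hc, theta n d c hc = y := by
  obtain ⟨f, hf, rfl⟩ := resTower.exists_cls n y
  obtain ⟨c, hc, rfl⟩ := exists_coHom f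
  exact ⟨c, ⟨hc, cobd_eq_zero hc hf⟩, rfl⟩

theorem IsCochain.add {n : ℤ} {d : ℤ × ℤ} {c c' : RMon → M2} (hc : IsCochain n d c)
    (hc' : IsCochain n d c') : IsCochain n d (c + c') := fun g =>
  ⟨add_mem (hc g).1 (hc' g).1, fun h => by
    rw [Pi.add_apply, (hc g).2 h, (hc' g).2 h, add_zero]⟩

theorem cobd_add (c c' : RMon → M2) : cobd (c + c') = cobd c + cobd c' := by
  funext g
  rcases g with k | ⟨i, k⟩ | ⟨_ | _ | _ | j, k⟩ <;> simp only [cobd, Pi.add_apply, add_zero] <;>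
    split_ifs <;> ring

theorem IsCocycle.add {n : ℕ} {d : ℤ × ℤ} {c c' : RMon → M2} (hc : IsCocycle n d c)
    (hc' : IsCocycle n d c') : IsCocycle n d (c + c') :=
  ⟨hc.1.add hc'.1, by rw [cobd_add, hc.2, hc'.2]; exact funext fun _ => add_zero _⟩

theorem theta_add {n : ℕ} {d : ℤ × ℤ} {c c' : RMon → M2} (hc : IsCocycle n d c)
    (hc' : IsCocycle n d c') :
    theta n d (c + c') (hc.add hc') = theta n d c hc + theta n d c' hc' := by
  have e : coHom n d (c + c') (hc.add hc').1 = coHom n d c hc.1 + coHom n d c' hc'.1 :=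
    ObjectProperty.hom_ext _ (NatTrans.ext (funext fun i => AddCommGrpCat.hom_ext
      (AddMonoidHom.ext fun z => Subtype.ext (pairing_add c c' z.1))))
  have h := resTower.cls_add n (coHom n d c hc.1) (coHom n d c' hc'.1) (resI_coHom hc)
    (resI_coHom hc') (e ▸ resI_coHom (hc.add hc'))
  refine Eq.trans ?_ h
  unfold theta
  congr 1

/-- The condition on cocycles that characterizes the coboundaries. -/
def IsBdry (c : RMon → M2) : Prop :=
  -- `.Y (j + 2) k` stands for y^{j+3} w^k, and `l ≠ 0` means divisibility by τ: the cochain is a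
  -- combination of the τ y^{j+3} w^{2m}.
  ∀ g l, (c g).coeff l ≠ 0 → ∃ j k, g = .Y (j + 2) k ∧ Even k ∧ l ≠ 0

theorem isBdry_cobd (c : RMon → M2) : IsBdry (cobd c) := fun g l h => by
  rcases g with k | ⟨i, k⟩ | ⟨_ | _ | _ | j, k⟩
  · exact absurd (Polynomial.coeff_zero l) h
  · exact absurd (Polynomial.coeff_zero l) h
  · exact absurd (Polynomial.coeff_zero l) h
  · exact absurd (Polynomial.coeff_zero l) h
  all_goals
    simp only [cobd] at h
    split_ifs at h with hk
    · refine ⟨_, k, rfl, hk, ?_⟩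
      rintro rfl
      exact h (Polynomial.mul_coeff_zero _ _ |>.trans (by simp [tau]))
    · exact absurd (Polynomial.coeff_zero l) h

/-- A cochain with given coboundary. -/
def primitive (c : RMon → M2) : RMon → M2
  | .W (k + 1) => if Even k then (c (.Y 2 k)).divX else 0
  | .Y j (k + 1) => if Even k then (c (.Y (j + 3) k)).divX else 0
  | _ => 0

theorem divX_mem {d e : ℤ × ℤ} {p : M2} (hp : p ∈ gradM2 d) (h : e + (0, 1) = d) :
    p.divX ∈ gradM2 e := fun k hk => by
  rw [Polynomial.coeff_divX] at hk
  rw [← add_left_inj ((0, 1) : ℤ × ℤ), h, ← hp (k + 1) hk]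
  ext <;> simp

theorem isCochain_primitive {n : ℕ} {d : ℤ × ℤ} {c : RMon → M2} (hc : IsCochain (n + 1 : ℕ) d c) :
    IsCochain n d (primitive c) := fun g => by
  rcases g with (_ | k) | ⟨i, k⟩ | ⟨j, _ | k⟩
  · exact ⟨zero_mem _, fun _ => rfl⟩
  · simp only [primitive]
    split_ifs
    · refine ⟨divX_mem (hc (.Y 2 k)).1 ?_, fun h => ?_⟩
      · ext <;> simp [RMon.ideg] <;> ring
      · rw [(hc (.Y 2 k)).2 (by simp only [RMon.hdeg] at h ⊢; push_cast at h ⊢; omega)]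
        exact Polynomial.divX_zero
    · exact ⟨zero_mem _, fun _ => rfl⟩
  · exact ⟨zero_mem _, fun _ => rfl⟩
  · exact ⟨zero_mem _, fun _ => rfl⟩
  · simp only [primitive]
    split_ifs
    · refine ⟨divX_mem (hc (.Y (j + 3) k)).1 ?_, fun h => ?_⟩
      · ext <;> simp [RMon.ideg] <;> ring
      · rw [(hc (.Y (j + 3) k)).2 (by simp only [RMon.hdeg] at h ⊢; push_cast at h ⊢; omega)]
        exact Polynomial.divX_zero
    · exact ⟨zero_mem _, fun _ => rfl⟩

/-- The primitive divides by τ (`divX`) and trades y³ w^k for w^{k+1}. The condition on `c` says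
that the division is exact and that nothing else occurs. -/
theorem cobd_primitive {c : RMon → M2} (hc : IsBdry c) : cobd (primitive c) = c := by
  have h0 (g : RMon) (hg : ∀ j k, Even k → g ≠ .Y (j + 2) k) : c g = 0 := by
    ext l
    by_contra h
    obtain ⟨j, k, rfl, hk, -⟩ := hc g l h
    exact hg j k hk rfl
  have h1 (g : RMon) : tau * (c g).divX = c g := by
    have : (c g).coeff 0 = 0 := by
      by_contra h
      obtain ⟨_, _, _, _, h'⟩ := hc g 0 h
      exact h' rfl
    conv_rhs => rw [← Polynomial.divX_mul_X_add (c g), this, map_zero, add_zero, mul_comm]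
    rfl
  funext g
  rcases g with k | ⟨i, k⟩ | ⟨_ | _ | _ | j, k⟩
  · exact (h0 _ (by simp)).symm
  · exact (h0 _ (by simp)).symm
  · exact (h0 _ (by simp)).symm
  · exact (h0 _ (by simp)).symm
  · by_cases hk : Even k
    · simp [cobd, primitive, hk, h1]
    · rw [h0 _ (by rintro j k' hk' h; simp at h; exact hk (h.2 ▸ hk'))]
      exact if_neg hk
  · by_cases hk : Even k
    · simp [cobd, primitive, hk, h1]
    · rw [h0 _ (by rintro j k' hk' h; simp at h; exact hk (h.2 ▸ hk'))]
      exact if_neg hk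

/-- In positive degree a class vanishes exactly when its cocycle is a coboundary. In degree 0 it
vanishes only for the zero cocycle, in agreement with `IsBdry`, whose monomials have homological
degree at least 3. -/
theorem theta_eq_zero_iff {n : ℕ} {d : ℤ × ℤ} {c : RMon → M2} (hc : IsCocycle n d c) :
    theta n d c hc = 0 ↔ IsBdry c := by
  cases n with
  | zero =>
    refine (resTower.cls_zero_eq_zero_iff _ _).trans ⟨fun h g l hl => ?_, fun h => ?_⟩
    · exfalso
      refine hl ?_
      by_cases hg : g.hdeg = (0 : ℕ)
      · have h' : coHom 0 d c hc.1 = 0 := h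
        rw [← coHom_resGen 0 d c hc.1 g hg, h']
        exact Polynomial.coeff_zero l
      · rw [(hc.1 g).2 hg, Polynomial.coeff_zero]
    · refine resP_hom_ext fun g hg => Subtype.ext ((coHom_resGen 0 d c hc.1 g hg).trans ?_)
      ext l
      by_contra hl
      obtain ⟨j, k, rfl, -⟩ := h g l hl
      simp only [RMon.hdeg] at hg
      push_cast at hg
      omega
  | succ n =>
    refine (resTower.cls_succ_eq_zero_iff n _ _).trans ⟨?_, fun h => ?_⟩
    · rintro ⟨f, hf⟩
      obtain ⟨c', hc', rfl⟩ := exists_coHom f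
      have : c = cobd c' := by
        funext g
        by_cases hg : g.hdeg = (n + 1 : ℕ)
        · have h1 : resBd n ≫ resI n ≫ coHom n d c' hc' = coHom (n + 1) d c hc.1 := hf
          rw [← coHom_resGen (n + 1) d c hc.1 g hg, ← h1]
          change pairing c' (diff (gen g 1)) = _
          rw [pairing_diff, pairing_gen, map_one, one_mul]
        · rw [(hc.1 g).2 hg]
          have hg' : gen g 1 ∈ resGrad g.hdeg g.ideg := gen_mem one_mem_gradA1 rfl (zero_add _)
          have e : cobd c' g = pairing c' (diff (gen g 1)) := by
            rw [pairing_diff, pairing_gen, map_one, one_mul]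
          rw [e]
          exact (pairing_eq_zero hc' (isHomog_diff.mem hg' rfl rfl)
            (by push_cast at hg; omega)).symm
      rw [this]
      exact isBdry_cobd c'
    · refine ⟨coHom n d (primitive c) (isCochain_primitive hc.1), ?_⟩
      refine ObjectProperty.hom_ext _ (NatTrans.ext (funext fun i => AddCommGrpCat.hom_ext
        (AddMonoidHom.ext fun z => Subtype.ext ?_)))
      change pairing (primitive c) (diff z.1) = pairing c z.1
      rw [pairing_diff, cobd_primitive h]

/-! ### Products -/

/-- The map between free modules given by a homogeneous linear map. -/
def opHom (F : Res →ₗ[A1] Res) {n : ℕ} {d : ℤ × ℤ} (hF : IsHomog F n d) (m : ℕ) :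
    resP (n + m) ⟶ (susp gradA1 d).obj (resP m) :=
  ObjectProperty.homMk
    { app := fun _ => AddCommGrpCat.ofHom (AddMonoidHom.mk'
        (fun z => (⟨F z.1, hF.mem z.2 (by push_cast; ring) rfl⟩ : resGrad m _))
          fun _ _ => Subtype.ext (map_add F _ _))
      naturality := fun _ _ x => AddCommGrpCat.hom_ext (AddMonoidHom.ext fun z =>
        Subtype.ext (map_smul F x.1 z.1)) }

/-- The composites enter as variables with equations, so that the concrete cocycles can be inserted
without rewriting inside dependent types. -/
theorem SyzygyTower.cls_comp_mapExactFunctor_cls_comp_mk₀ {C : Type*} [Category C] [Abelian C]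
    [HasExt C] (S : SyzygyTower C) (F : C ⥤ C) [F.Additive] [PreservesFiniteLimits F]
    [PreservesFiniteColimits F] (n : ℕ) (L : ∀ m, S.P (n + m) ⟶ F.obj (S.P m))
    (hL : ∀ m, L (m + 1) ≫ F.map (S.π (m + 1) ≫ S.i m) = (S.π (n + m + 1) ≫ S.i (n + m)) ≫ L m)
    (f : S.P n ⟶ F.obj (S.K 0)) (hf : S.i n ≫ f = 0) (hf' : f = L 0 ≫ F.map (S.π 0))
    (m : ℕ) {Y Z : C} (g : S.P m ⟶ Y) (hg : S.i m ≫ g = 0)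
    (hLg : S.i (n + m) ≫ L m ≫ F.map g = 0) (s : F.obj Y ⟶ Z) (k : S.P (n + m) ⟶ Z)
    (hk : S.i (n + m) ≫ k = 0) (hk' : (L m ≫ F.map g) ≫ s = k) :
    ((S.cls n f hf : Ext _ _ _).comp ((S.cls m g hg).mapExactFunctor F) rfl).comp
      (Ext.mk₀ s) (add_zero _) = S.cls (n + m) k hk := by
  subst hf' hk'
  rw [S.cls_comp_mapExactFunctor_cls F n L hL hf m g hg hLg]
  exact S.cls_comp_mk₀ _ _ _ _ _

theorem opHom_comp_susp {F : Res →ₗ[A1] Res} {n : ℕ} {d : ℤ × ℤ} (hF : IsHomog F n d)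
    (hF' : IsChain F) (m : ℕ) :
    opHom F hF (m + 1) ≫ (susp gradA1 d).map (resBd m ≫ resI m) =
      (resBd (n + m) ≫ resI (n + m)) ≫ opHom F hF m :=
  ObjectProperty.hom_ext _ (NatTrans.ext (funext fun _ => AddCommGrpCat.hom_ext
    (AddMonoidHom.ext fun z => Subtype.ext (hF' z.1))))

theorem coHom_eq_opHom_comp {F : Res →ₗ[A1] Res} {n : ℕ} {d : ℤ × ℤ} (hF : IsHomog F n d)
    {c : RMon → M2} (hc : IsCochain n d c) (h : ∀ z, pairing epsCochain (F z) = pairing c z) :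
    coHom n d c hc = opHom F hF 0 ≫ (susp gradA1 d).map resAug :=
  ObjectProperty.hom_ext _ (NatTrans.ext (funext fun _ => AddCommGrpCat.hom_ext
    (AddMonoidHom.ext fun z => Subtype.ext (h z.1).symm)))

theorem opHom_comp_coHom {F : Res →ₗ[A1] Res} {n m : ℕ} {d e : ℤ × ℤ} (hF : IsHomog F n d)
    {c' c'' : RMon → M2} (hc' : IsCochain m e c') (hc'' : IsCochain (n + m : ℕ) (d + e) c'')
    (h' : ∀ z, pairing c' (F z) = pairing c'' z) :
    (opHom F hF m ≫ (susp gradA1 d).map (coHom m e c' hc')) ≫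
      suspSusp gradA1 unitModule d e = coHom (n + m) (d + e) c'' hc'' := by
  refine ObjectProperty.hom_ext _ (NatTrans.ext (funext fun i => AddCommGrpCat.hom_ext
    (AddMonoidHom.ext fun z => Subtype.ext ?_)))
  -- The identification of the double suspension acts through 1 in `A(1)`, which on 𝔽₂[τ] is
  -- multiplication by the augmentation of 1.
  change augmentation 1 * pairing c' (F z.1) = pairing c'' z.1
  rw [map_one, one_mul, h']

theorem resI_opHom_comp_coHom {F : Res →ₗ[A1] Res} {n m : ℕ} {d e : ℤ × ℤ} (hF : IsHomog F n d)
    {c' c'' : RMon → M2} (hc' : IsCochain m e c') (hc'' : IsCocycle (n + m) (d + e) c'')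
    (h' : ∀ z, pairing c' (F z) = pairing c'' z) :
    resI (n + m) ≫ opHom F hF m ≫ (susp gradA1 d).map (coHom m e c' hc') = 0 := by
  refine ObjectProperty.hom_ext _ (NatTrans.ext (funext fun i => AddCommGrpCat.hom_ext
    (AddMonoidHom.ext fun z => Subtype.ext ?_)))
  change pairing c' (F z.1) = 0
  rw [h', pairing_eq_zero_of_mem hc'' z.2]

/-- A chain map `F` whose augmentation is the cocycle `c` is a lift of `c`, so the product with `c`
is precomposition with `F`. -/
theorem yonedaMul_theta {F : Res →ₗ[A1] Res} {n m : ℕ} {d e : ℤ × ℤ} (hF : IsHomog F n d)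
    (hF' : IsChain F) {c c' c'' : RMon → M2} (hc : IsCocycle n d c) (hc' : IsCocycle m e c')
    (hc'' : IsCocycle (n + m) (d + e) c'')
    (h : ∀ z, pairing epsCochain (F z) = pairing c z)
    (h' : ∀ z, pairing c' (F z) = pairing c'' z) :
    yonedaMul gradA1 unitModule (theta n d c hc) (theta m e c' hc') =
      theta (n + m) (d + e) c'' hc'' :=
  resTower.cls_comp_mapExactFunctor_cls_comp_mk₀ (susp gradA1 d) n (opHom F hF)
    (opHom_comp_susp hF hF') (coHom n d c hc.1) (resI_coHom hc) (coHom_eq_opHom_comp hF hc.1 h) m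
    (coHom m e c' hc'.1) (resI_coHom hc') (resI_opHom_comp_coHom hF hc'.1 hc'' h')
    (suspSusp gradA1 unitModule d e) (coHom (n + m) (d + e) c'' hc''.1) (resI_coHom hc'')
    (opHom_comp_coHom hF hc'.1 hc''.1 h')

/-! ### The cochains of the polynomials in the generators -/

/-- The specialization of the generators `h₀`, `h₁`, `α`, `β` to `x`, `0`, `x w`, `w ^ 2`. -/
def evx : GenRing →ₐ[M2] Polynomial (Polynomial M2) :=
  MvPolynomial.aeval (![Polynomial.X, 0, Polynomial.X * Polynomial.C Polynomial.X,
    Polynomial.C (Polynomial.X ^ 2)] : Fin 4 → Polynomial (Polynomial M2))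

/-- The specialization of the generators `h₀`, `h₁`, `α`, `β` to `0`, `y`, `0`, `w ^ 2`. -/
def evy : GenRing →ₐ[M2] Polynomial (Polynomial M2) :=
  MvPolynomial.aeval
    (![0, Polynomial.X, 0, Polynomial.C (Polynomial.X ^ 2)] : Fin 4 → Polynomial (Polynomial M2))

theorem evx_X : evx (.X 0) = Polynomial.X ∧ evx (.X 1) = 0 ∧
    evx (.X 2) = Polynomial.X * Polynomial.C Polynomial.X ∧
    evx (.X 3) = Polynomial.C (Polynomial.X ^ 2) := by
  simp [evx]

theorem evy_X : evy (.X 0) = 0 ∧ evy (.X 1) = Polynomial.X ∧ evy (.X 2) = 0 ∧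
    evy (.X 3) = Polynomial.C (Polynomial.X ^ 2) := by
  simp [evy]

/-- The ring 𝔽₂[τ][x, y, w]/(xy) consists of the pairs in 𝔽₂[τ][x, w] × 𝔽₂[τ][y, w] that agree at x
= 0 and y = 0. Hence the coefficients at powers of w may be read from either specialization. -/
theorem coeff_zero_evx (r : GenRing) : (evx r).coeff 0 = (evy r).coeff 0 := by
  induction r using MvPolynomial.induction_on with
  | C p =>
    have hx : evx (.C p) = .C (.C p) := evx.commutes p
    have hy : evy (.C p) = .C (.C p) := evy.commutes p
    rw [hx, hy]
  | add r r' h h' => rw [map_add, map_add, Polynomial.coeff_add, Polynomial.coeff_add, h, h']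
  | mul_X r i h =>
    rw [map_mul, map_mul, Polynomial.mul_coeff_zero, Polynomial.mul_coeff_zero, h]
    refine congrArg _ ?_
    obtain rfl | rfl | rfl | rfl : i = 0 ∨ i = 1 ∨ i = 2 ∨ i = 3 := by fin_cases i <;> simp
    all_goals simp [evx_X, evy_X]

/-- The cochain with the coefficients of the specializations of a polynomial. -/
def coch (r : GenRing) : RMon → M2
  | .W k => ((evx r).coeff 0).coeff k
  | .X i k => ((evx r).coeff (i + 1)).coeff k
  | .Y j k => ((evy r).coeff (j + 1)).coeff k

theorem coch_add (r r' : GenRing) : coch (r + r') = coch r + coch r' := by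
  funext g
  rcases g with k | ⟨i, k⟩ | ⟨j, k⟩ <;> simp [coch]

theorem coch_smul (p : M2) (r : GenRing) (g : RMon) : coch (p • r) g = p * coch r g := by
  rcases g with k | ⟨i, k⟩ | ⟨j, k⟩ <;> simp [coch]

theorem coch_one : coch 1 = epsCochain := by
  funext g
  rcases g with (_ | k) | ⟨i, k⟩ | ⟨j, k⟩ <;>
    simp [coch, epsCochain, Polynomial.coeff_one]

/-- The transpose of the chain map is multiplication by x: coefficients 1 shift the exponent, and
the others have zero augmentation. The other three generators behave alike. -/
theorem coch_h0_mul (r : GenRing) (g : RMon) :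
    coch (.X 0 * r) g = pairing (coch r) (h0Gen g) := by
  rcases g with k | ⟨_ | i, k⟩ | ⟨_ | _ | j, k⟩ <;>
    simp [coch, h0Gen, pairing_gen, pairing_genPred, pairing_ev, evx_X, evy_X]

theorem coch_h1_mul (r : GenRing) (g : RMon) :
    coch (.X 1 * r) g = pairing (coch r) (h1Gen g) := by
  rcases g with k | ⟨i, k⟩ | ⟨_ | j, k⟩ <;>
    simp [coch, h1Gen, pairing_gen, pairing_genPred, evx_X, evy_X, coeff_zero_evx]

theorem coch_alpha_mul (r : GenRing) (g : RMon) :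
    coch (.X 2 * r) g = pairing (coch r) (alphaGen g) := by
  rcases g with (_ | _ | k) | ⟨_ | i, _ | k⟩ | ⟨_ | _ | j, _ | k⟩ <;>
    simp [coch, alphaGen, genPred, pairing_gen, pairing_ev, evx_X, evy_X, mul_assoc]

theorem coch_beta_mul (r : GenRing) (g : RMon) :
    coch (.X 3 * r) g = pairing (coch r) (betaGen g) := by
  rcases g with (_ | _ | k) | ⟨i, _ | _ | k⟩ | ⟨j, _ | _ | k⟩ <;>
    simp [coch, betaGen, pairing_gen, evx_X, evy_X, Polynomial.coeff_X_pow_mul', -map_pow]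

/-- Since α specializes to 0 at x = 0, w accompanies y only through β = w². -/
theorem coch_Y_odd (r : GenRing) (j k : ℕ) (hk : ¬ Even k) : coch r (.Y j k) = 0 := by
  change ((evy r).coeff (j + 1)).coeff k = 0
  generalize j + 1 = i
  induction r using MvPolynomial.induction_on generalizing i k with
  | C p =>
    have : evy (.C p) = .C (.C p) := evy.commutes p
    rw [this, Polynomial.coeff_C]
    split_ifs
    · rw [Polynomial.coeff_C, if_neg]
      rintro rfl
      exact hk Even.zero
    · rfl
  | add r r' h h' =>
    rw [map_add, Polynomial.coeff_add, Polynomial.coeff_add, h _ hk, h' _ hk, add_zero]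
  | mul_X r i' h =>
    rw [map_mul]
    fin_cases i'
    · simp [evy_X]
    · rcases i with _ | i
      · simp [evy_X]
      · simp [evy_X, h k hk]
    · simp [evy_X]
    · rcases k with _ | _ | k
      · exact absurd Even.zero hk
      · simp [evy_X, Polynomial.coeff_mul_X_pow', -map_pow]
      · simp [evy_X, h k (by simpa [Nat.even_add] using hk), Polynomial.coeff_mul_X_pow', -map_pow]

/-! ### Normal forms modulo the relations -/

/-- The monomials in normal form modulo the relations. -/
inductive NormalMon : Type
  /-- `β ^ k` -/
  | W (k : ℕ)
  /-- `h₀ ^ (i + 1) β ^ k` -/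
  | X (i k : ℕ)
  /-- `h₀ ^ i α β ^ k` -/
  | A (i k : ℕ)
  /-- `h₁ ^ (j + 1) β ^ k` -/
  | Y (j k : ℕ)

namespace NormalMon

/-- The monomial, as a polynomial. -/
def poly : NormalMon → GenRing
  | W k => .X 3 ^ k
  | X i k => .X 0 ^ (i + 1) * .X 3 ^ k
  | A i k => .X 0 ^ i * .X 2 * .X 3 ^ k
  | Y j k => .X 1 ^ (j + 1) * .X 3 ^ k

/-- The specialization of the monomial. -/
def mon : NormalMon → RMon
  | W k => .W (2 * k)
  | X i k => .X i (2 * k)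
  | A i k => .X i (2 * k + 1)
  | Y j k => .Y j (2 * k)

/-- The parity of the exponent of w tells h₀^{i+1}β^k from h₀^iαβ^k. -/
theorem mon_injective : Function.Injective mon := fun a b h => by
  cases a <;> cases b <;> simp [mon] at h ⊢ <;> omega

theorem coeff_X_pow_mul_C (a b i k : ℕ) :
    (((Polynomial.X ^ a * Polynomial.C (Polynomial.X ^ b) : Polynomial (Polynomial M2)).coeff
      i).coeff k) = if i = a ∧ k = b then 1 else 0 := by
  rw [Polynomial.coeff_mul_C, Polynomial.coeff_X_pow, ite_mul, one_mul, zero_mul]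
  by_cases h : i = a
  · simp [h, Polynomial.coeff_X_pow]
  · simp [h]

theorem evx_poly : ∀ a : NormalMon, evx a.poly = match a with
  | W k => Polynomial.X ^ 0 * Polynomial.C (Polynomial.X ^ (2 * k))
  | X i k => Polynomial.X ^ (i + 1) * Polynomial.C (Polynomial.X ^ (2 * k))
  | A i k => Polynomial.X ^ (i + 1) * Polynomial.C (Polynomial.X ^ (2 * k + 1))
  | Y _ _ => 0 := by
  rintro (k | ⟨i, k⟩ | ⟨i, k⟩ | ⟨j, k⟩) <;> simp [poly, evx_X] <;> ring

theorem evy_poly : ∀ a : NormalMon, evy a.poly = match a with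
  | W k => Polynomial.X ^ 0 * Polynomial.C (Polynomial.X ^ (2 * k))
  | X _ _ => 0
  | A _ _ => 0
  | Y j k => Polynomial.X ^ (j + 1) * Polynomial.C (Polynomial.X ^ (2 * k)) := by
  rintro (k | ⟨i, k⟩ | ⟨i, k⟩ | ⟨j, k⟩) <;> simp [poly, evy_X] <;> ring

theorem coch_poly (a : NormalMon) (g : RMon) : coch a.poly g = if g = a.mon then 1 else 0 := by
  rcases a with k | ⟨i, k⟩ | ⟨i, k⟩ | ⟨j, k⟩ <;> rcases g with k' | ⟨i', k'⟩ | ⟨j', k'⟩ <;>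
    simp only [coch, evx_poly, evy_poly, coeff_X_pow_mul_C, mon] <;> simp

end NormalMon

/-- The polynomials that are linear combinations of monomials in normal form, modulo the
relations. -/
def normalSpan : Submodule M2 GenRing :=
  Submodule.span M2 (Set.range NormalMon.poly) ⊔ relIdeal.restrictScalars M2

theorem poly_mem_normalSpan (a : NormalMon) : a.poly ∈ normalSpan :=
  Submodule.mem_sup_left (Submodule.subset_span ⟨a, rfl⟩)

theorem mem_normalSpan_of_mem {r : GenRing} (h : r ∈ relIdeal) : r ∈ normalSpan :=
  Submodule.mem_sup_right h

theorem relIdeal_gens : (.X 0 * .X 1 : GenRing) ∈ relIdeal ∧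
    (.C tau * .X 1 ^ 3 : GenRing) ∈ relIdeal ∧ (.X 1 * .X 2 : GenRing) ∈ relIdeal ∧
    (.X 2 ^ 2 - .X 0 ^ 2 * .X 3 : GenRing) ∈ relIdeal := by
  refine ⟨?_, ?_, ?_, ?_⟩ <;> exact Ideal.subset_span (by simp)

/-- A product is again normal, or divisible by h₀h₁ or h₁α, or contains α² and is rewritten by α² =
h₀²β. The relation τh₁³ = 0 plays no part: it restricts the coefficients of h₁^{j+3}β^k, not the
monomials. -/
theorem X_mul_poly_mem (i : Fin 4) (a : NormalMon) : .X i * a.poly ∈ normalSpan := by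
  have key (b : NormalMon) (h : .X i * a.poly = b.poly) : .X i * a.poly ∈ normalSpan :=
    h ▸ poly_mem_normalSpan b
  have rel (g s : GenRing) (hg : g ∈ relIdeal) (h : .X i * a.poly = g * s) :
      .X i * a.poly ∈ normalSpan :=
    h ▸ mem_normalSpan_of_mem (Ideal.mul_mem_right _ _ hg)
  obtain ⟨r1, -, r3, r4⟩ := relIdeal_gens
  obtain rfl | rfl | rfl | rfl : i = 0 ∨ i = 1 ∨ i = 2 ∨ i = 3 := by fin_cases i <;> simp
  all_goals rcases a with k | ⟨i, k⟩ | ⟨i, k⟩ | ⟨j, k⟩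
  · exact key (.X 0 k) (by simp [NormalMon.poly])
  · exact key (.X (i + 1) k) (by simp only [NormalMon.poly]; ring)
  · exact key (.A (i + 1) k) (by simp only [NormalMon.poly]; ring)
  · exact rel _ (.X 1 ^ j * .X 3 ^ k) r1 (by simp only [NormalMon.poly]; ring)
  · exact key (.Y 0 k) (by simp [NormalMon.poly])
  · exact rel _ (.X 0 ^ i * .X 3 ^ k) r1 (by simp only [NormalMon.poly]; ring)
  · exact rel _ (.X 0 ^ i * .X 3 ^ k) r3 (by simp only [NormalMon.poly]; ring)
  · exact key (.Y (j + 1) k) (by simp only [NormalMon.poly]; ring)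
  · exact key (.A 0 k) (by simp [NormalMon.poly])
  · exact key (.A (i + 1) k) (by simp only [NormalMon.poly]; ring)
  · have e : (.X 2 * NormalMon.poly (.A i k) : GenRing) = NormalMon.poly (.X (i + 1) (k + 1)) +
        (.X 2 ^ 2 - .X 0 ^ 2 * .X 3) * (.X 0 ^ i * .X 3 ^ k) := by
      simp only [NormalMon.poly]; ring
    rw [e]
    exact add_mem (poly_mem_normalSpan _) (mem_normalSpan_of_mem (Ideal.mul_mem_right _ _ r4))
  · exact rel _ (.X 1 ^ j * .X 3 ^ k) r3 (by simp only [NormalMon.poly]; ring)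
  · exact key (.W (k + 1)) (by simp only [NormalMon.poly]; ring)
  · exact key (.X i (k + 1)) (by simp only [NormalMon.poly]; ring)
  · exact key (.A i (k + 1)) (by simp only [NormalMon.poly]; ring)
  · exact key (.Y j (k + 1)) (by simp only [NormalMon.poly]; ring)

theorem X_mul_mem_normalSpan (i : Fin 4) {r : GenRing} (h : r ∈ normalSpan) :
    .X i * r ∈ normalSpan := by
  obtain ⟨s, hs, t, ht, rfl⟩ := Submodule.mem_sup.1 h
  rw [mul_add]
  refine add_mem ?_ (mem_normalSpan_of_mem (Ideal.mul_mem_left _ _ ht))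
  clear h ht
  induction hs using Submodule.span_induction with
  | mem s hs => obtain ⟨a, rfl⟩ := hs; exact X_mul_poly_mem i a
  | zero => rw [mul_zero]; exact zero_mem _
  | add s s' _ _ h h' => rw [mul_add]; exact add_mem h h'
  | smul p s _ h => rw [mul_smul_comm]; exact Submodule.smul_mem _ _ h

theorem mem_normalSpan (r : GenRing) : r ∈ normalSpan := by
  induction r using MvPolynomial.induction_on with
  | C p =>
    have : (.C p : GenRing) = p • NormalMon.poly (.W 0) := by
      rw [MvPolynomial.smul_eq_C_mul]; simp [NormalMon.poly]
    rw [this]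
    exact Submodule.smul_mem _ _ (poly_mem_normalSpan _)
  | add r r' h h' => exact add_mem h h'
  | mul_X r i h => rw [mul_comm]; exact X_mul_mem_normalSpan i h

theorem IsBdry.add {c c' : RMon → M2} (hc : IsBdry c) (hc' : IsBdry c') : IsBdry (c + c') :=
  fun g l h => by
    by_cases h' : (c g).coeff l = 0
    · exact hc' g l fun h'' => h (by rw [Pi.add_apply, Polynomial.coeff_add, h', h'', add_zero])
    · exact hc g l h'

/-- Three of the relations specialize to zero, and τh₁³ to the coboundary τ y³. -/
theorem isBdry_coch_of_mem {r : GenRing} (h : r ∈ relIdeal) : IsBdry (coch r) := by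
  -- Quantifying over all multiples makes the induction over the ideal close under multiplication.
  suffices H : ∀ s, IsBdry (coch (s * r)) by simpa using H 1
  induction h using Submodule.span_induction with
  | mem r hr =>
    intro s
    obtain rfl | rfl | rfl | rfl := hr
    · intro g l hl
      exfalso
      rcases g with k | ⟨i, k⟩ | ⟨j, k⟩ <;> simp [coch, evx_X, evy_X] at hl
    · intro g l hl
      have hy : evy (s * (.C tau * .X 1 ^ 3)) = Polynomial.X ^ 3 * (tau • evy s) := by
        have ht : evy (.C tau) = algebraMap M2 _ tau := evy.commutes tau
        rw [map_mul, map_mul, map_pow, evy_X.2.1, ht, Algebra.smul_def]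
        ring
      rcases g with k | ⟨i, k⟩ | ⟨j, k⟩
      · simp [coch, evx_X] at hl
      · simp [coch, evx_X] at hl
      · rcases j with _ | _ | j
        · simp only [coch, hy] at hl
          simp [Polynomial.coeff_X_pow_mul'] at hl
        · simp only [coch, hy] at hl
          simp [Polynomial.coeff_X_pow_mul'] at hl
        · refine ⟨j, k, rfl, ?_, ?_⟩
          · by_contra hk
            rw [coch_Y_odd _ _ _ hk] at hl
            exact hl (Polynomial.coeff_zero l)
          · rintro rfl
            simp only [coch, hy] at hl
            simp [Polynomial.coeff_X_pow_mul', tau] at hl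
    · intro g l hl
      exfalso
      rcases g with k | ⟨i, k⟩ | ⟨j, k⟩ <;> simp [coch, evx_X, evy_X] at hl
    · intro g l hl
      exfalso
      have hx : evx (s * (.X 2 ^ 2 - .X 0 ^ 2 * .X 3)) = 0 := by
        simp only [map_mul, map_sub, map_pow, evx_X]
        ring
      rcases g with k | ⟨i, k⟩ | ⟨j, k⟩
      · simp only [coch, hx] at hl
        simp at hl
      · simp only [coch, hx] at hl
        simp at hl
      · simp [coch, evy_X] at hl
  | zero =>
    intro s g l hl
    rw [mul_zero] at hl
    exfalso
    rcases g with k | ⟨i, k⟩ | ⟨j, k⟩ <;> simp [coch] at hl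
  | add r r' _ _ h h' => intro s; rw [mul_add, coch_add]; exact (h s).add (h' s)
  | smul t r _ h => intro s; rw [smul_eq_mul, ← mul_assoc]; exact h _

theorem coch_sum {ι : Type*} (s : Finset ι) (f : ι → GenRing) (g : RMon) :
    coch (∑ i ∈ s, f i) g = ∑ i ∈ s, coch (f i) g := by
  classical
  induction s using Finset.induction_on with
  | empty => rcases g with k | ⟨i, k⟩ | ⟨j, k⟩ <;> simp [coch]
  | insert i s hi ih => rw [Finset.sum_insert hi, Finset.sum_insert hi, coch_add, ← ih]; rfl

theorem coch_sum_poly (s : Finset NormalMon) (c : NormalMon → M2) (a : NormalMon) (ha : a ∈ s) :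
    coch (∑ b ∈ s, c b • b.poly) a.mon = c a := by
  rw [coch_sum, Finset.sum_eq_single a]
  · rw [coch_smul, NormalMon.coch_poly, if_pos rfl, mul_one]
  · intro b _ hb
    rw [coch_smul, NormalMon.coch_poly, if_neg fun h => hb (NormalMon.mon_injective h).symm,
      mul_zero]
  · exact fun h => absurd ha h

theorem genRing_sub_eq_add (r r' : GenRing) : r - r' = r + r' := by
  have : r' + r' = 0 := by
    rw [← two_smul M2]
    simp only [CharTwo.two_eq_zero (R := M2), zero_smul]
  rw [sub_eq_iff_eq_add, add_assoc, this, add_zero]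

/-- In normal form the coefficients are the values of the cochain at distinct monomials. For a
coboundary the nonzero ones sit at h₁^{j+3}β^k and are divisible by τ, so each term is a multiple of
τh₁³. -/
theorem mem_relIdeal_iff (r : GenRing) : r ∈ relIdeal ↔ IsBdry (coch r) := by
  refine ⟨isBdry_coch_of_mem, fun h => ?_⟩
  obtain ⟨s, hs, t, ht, rfl⟩ := Submodule.mem_sup.1 (mem_normalSpan r)
  refine add_mem ?_ ht
  have h' : IsBdry (coch s) := by
    have := h.add (isBdry_coch_of_mem ht)
    rwa [← coch_add, ← genRing_sub_eq_add, add_sub_cancel_right] at this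
  obtain ⟨c, rfl⟩ := (Finsupp.mem_span_range_iff_exists_finsupp).1 hs
  refine sum_mem fun a ha => ?_
  have hc : coch (c.sum fun a p => p • a.poly) a.mon = c a := coch_sum_poly c.support c a ha
  rw [Finsupp.mem_support_iff] at ha
  obtain ⟨l, hl⟩ : ∃ l, (c a).coeff l ≠ 0 := by
    by_contra! hl
    exact ha (Polynomial.ext hl)
  obtain ⟨j, k, e, -, -⟩ := h' a.mon l (by rw [hc]; exact hl)
  have h0 : (c a).coeff 0 = 0 := by
    by_contra h0
    obtain ⟨_, _, _, _, h1⟩ := h' a.mon 0 (by rw [hc]; exact h0)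
    exact h1 rfl
  obtain ⟨q, hq⟩ := Polynomial.X_dvd_iff.2 h0
  rcases a with k' | ⟨i, k'⟩ | ⟨i, k'⟩ | ⟨j', k'⟩ <;> simp only [NormalMon.mon, reduceCtorEq,
    RMon.Y.injEq] at e
  obtain ⟨rfl, -⟩ := e
  have : c (.Y (j + 2) k') • NormalMon.poly (.Y (j + 2) k') =
      (.C tau * .X 1 ^ 3 : GenRing) * (.C q * .X 1 ^ j * .X 3 ^ k') := by
    rw [hq, MvPolynomial.smul_eq_C_mul, map_mul]
    simp only [NormalMon.poly, tau]
    ring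
  simp only [this]
  exact Ideal.mul_mem_right _ _ relIdeal_gens.2.1

/-! ### The polynomials that are represented by chain maps -/

/-- The polynomials whose product with any other polynomial is represented by a chain map of
homological degree `n` and internal bidegree `d`. -/
def IsRepr (n : ℤ) (d : ℤ × ℤ) (r : GenRing) : Prop :=
  ∃ F : Res →ₗ[A1] Res, IsChain F ∧ IsHomog F n d ∧
    ∀ s z, pairing (coch s) (F z) = pairing (coch (r * s)) z

theorem isRepr_resLift {n : ℤ} {d : ℤ × ℤ} {r : GenRing} {G : RMon → Res}
    (hG : IsChain (resLift G)) (hG' : IsHomog (resLift G) n d)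
    (h : ∀ s g, coch (r * s) g = pairing (coch s) (G g)) : IsRepr n d r :=
  ⟨_, hG, hG', fun s z => by rw [pairing_resLift, ← funext (h s)]⟩

theorem isRepr_X : IsRepr 1 (1, 0) (.X 0) ∧ IsRepr 1 (2, 1) (.X 1) ∧ IsRepr 3 (7, 2) (.X 2) ∧
    IsRepr 4 (12, 4) (.X 3) :=
  ⟨isRepr_resLift isChain_h0 isHomog_h0 coch_h0_mul,
    isRepr_resLift isChain_h1 isHomog_h1 coch_h1_mul,
    isRepr_resLift isChain_alpha isHomog_alpha coch_alpha_mul,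
    isRepr_resLift isChain_beta isHomog_beta coch_beta_mul⟩

theorem IsRepr.mul {n m : ℤ} {d e : ℤ × ℤ} {r s : GenRing} (hr : IsRepr n d r)
    (hs : IsRepr m e s) : IsRepr (n + m) (d + e) (r * s) := by
  obtain ⟨F, h1, h2, h3⟩ := hr
  obtain ⟨G, h1', h2', h3'⟩ := hs
  refine ⟨G ∘ₗ F, fun z => ?_, fun k b z hz => ?_, fun t z => ?_⟩
  · rw [LinearMap.comp_apply, h1', h1, LinearMap.comp_apply]
  · exact h2'.mem (h2.mem hz rfl rfl) (sub_sub _ _ _) (sub_sub _ _ _)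
  · rw [LinearMap.comp_apply, h3', h3, mul_assoc]

theorem IsRepr.add {n : ℤ} {d : ℤ × ℤ} {r s : GenRing} (hr : IsRepr n d r)
    (hs : IsRepr n d s) : IsRepr n d (r + s) := by
  obtain ⟨F, h1, h2, h3⟩ := hr
  obtain ⟨G, h1', h2', h3'⟩ := hs
  refine ⟨F + G, fun z => ?_, fun k b z hz => ?_, fun t z => ?_⟩
  · rw [LinearMap.add_apply, LinearMap.add_apply, map_add, h1, h1']
  · exact add_mem (h2.mem hz rfl rfl) (h2'.mem hz rfl rfl)
  · rw [LinearMap.add_apply, map_add, h3, h3', add_mul, coch_add, pairing_add]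

theorem coch_zero : coch 0 = fun _ => 0 := by
  funext g
  rcases g with k | ⟨i, k⟩ | ⟨j, k⟩ <;> simp [coch]

theorem isRepr_zero (n : ℤ) (d : ℤ × ℤ) : IsRepr n d 0 :=
  ⟨0, fun z => map_zero diff, fun k b z hz => zero_mem _, fun t z => by
    rw [zero_mul, coch_zero, pairing_zero_left]; exact map_zero _⟩

theorem IsRepr.sum {ι : Type*} {n : ℤ} {d : ℤ × ℤ} {s : Finset ι} {f : ι → GenRing}
    (h : ∀ i ∈ s, IsRepr n d (f i)) : IsRepr n d (∑ i ∈ s, f i) := by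
  classical
  induction s using Finset.induction_on with
  | empty => exact isRepr_zero n d
  | insert i s hi ih =>
    rw [Finset.sum_insert hi]
    exact (h i (Finset.mem_insert_self i s)).add
      (ih fun j hj => h j (Finset.mem_insert_of_mem hj))

theorem coch_C_mul (p : M2) (s : GenRing) (g : RMon) :
    coch (.C p * s) g = pairing (coch s) (p • gen g 1) := by
  rw [← MvPolynomial.smul_eq_C_mul, coch_smul, map_smul, pairing_gen, map_one, one_mul,
    smul_eq_mul]

theorem isRepr_C {d : ℤ × ℤ} {p : M2} (hp : p ∈ gradM2 (-d)) : IsRepr 0 d (.C p) := by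
  have e (z : Res) : resLift (fun g => p • gen g 1) z = p • z := by
    induction z using Finsupp.induction_linear with
    | zero => rw [map_zero, smul_zero]
    | add y z hy hz => rw [map_add, hy, hz, smul_add]
    | single g y =>
      change resLift _ (gen g y) = p • gen g y
      rw [resLift_gen, smul_comm, smul_gen, mul_one]
  refine isRepr_resLift (fun z => ?_) (fun k b z hz => ?_) (coch_C_mul p)
  · rw [e, e]
    exact LinearMap.map_smul_of_tower diff p z
  · rw [e, sub_zero]
    exact m2_smul_mem_resGrad hp hz (by abel)

theorem isRepr_one : IsRepr 0 0 1 :=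
  isRepr_C (p := 1) (by rw [neg_zero]; exact SetLike.GradedOne.one_mem)

theorem IsRepr.pow {n : ℤ} {d : ℤ × ℤ} {r : GenRing} (hr : IsRepr n d r) (k : ℕ) :
    IsRepr (k * n) (k • d) (r ^ k) := by
  induction k with
  | zero => simpa using isRepr_one
  | succ k ih =>
    rw [pow_succ, succ_nsmul]
    convert ih.mul hr using 1
    push_cast
    ring

theorem NormalMon.isRepr_poly (a : NormalMon) : IsRepr a.mon.hdeg a.mon.ideg a.poly := by
  obtain ⟨h0, h1, h2, h3⟩ := isRepr_X
  rcases a with k | ⟨i, k⟩ | ⟨i, k⟩ | ⟨j, k⟩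
  · convert h3.pow k using 1
    · simp [mon, RMon.hdeg]; ring
    · ext <;> simp [mon, RMon.ideg] <;> ring
    · rfl
  · convert (h0.pow (i + 1)).mul (h3.pow k) using 1
    · simp [mon, RMon.hdeg]; ring
    · ext <;> simp [mon, RMon.ideg] <;> ring
    · rfl
  · convert ((h0.pow i).mul h2).mul (h3.pow k) using 1
    · simp [mon, RMon.hdeg]; ring
    · ext <;> simp [mon, RMon.ideg] <;> ring
    · rfl
  · convert (h1.pow (j + 1)).mul (h3.pow k) using 1
    · simp [mon, RMon.hdeg]; ring
    · ext <;> simp [mon, RMon.ideg] <;> ring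
    · rfl

/-- The cochain is the augmentation composed with a chain map, and the augmentation vanishes on
boundaries. -/
theorem IsRepr.isCocycle {n : ℕ} {d : ℤ × ℤ} {r : GenRing} (hr : IsRepr n d r) :
    IsCocycle n d (coch r) := by
  obtain ⟨F, h1, h2, h3⟩ := hr
  have h (z : Res) : pairing (coch r) z = pairing epsCochain (F z) := by
    rw [← coch_one, h3, mul_one]
  have h' (g : RMon) (c : RMon → M2) : c g = pairing c (gen g 1) := by
    rw [pairing_gen, map_one, one_mul]
  refine ⟨fun g => ?_, ?_⟩
  · have hg : gen g 1 ∈ resGrad g.hdeg g.ideg := gen_mem one_mem_gradA1 rfl (zero_add _)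
    have hF := h2.mem hg rfl rfl
    rw [h' g (coch r), h]
    refine ⟨?_, fun hn => pairing_eq_zero isCochain_eps hF (sub_ne_zero.2 hn)⟩
    by_cases hn : g.hdeg = n
    · have := pairing_mem isCochain_eps (h2.mem hg (sub_eq_zero.2 hn) rfl)
      rwa [sub_zero] at this
    · rw [pairing_eq_zero isCochain_eps hF (sub_ne_zero.2 hn)]
      exact zero_mem _
  · funext g
    rw [h' g (cobd (coch r)), ← pairing_diff, h, ← h1, pairing_diff, cobd_eps, pairing_zero_left]

/-- The coboundary carries w^{2k+1} and y^j w^{2k+1} to τ times distinct monomials and τ is not a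
zero divisor, so these do not occur in a cocycle. The remaining monomials are the normal ones. -/
theorem IsCocycle.exists_mon_eq {n : ℕ} {d : ℤ × ℤ} {c : RMon → M2} (hc : IsCocycle n d c)
    {g : RMon} (hg : c g ≠ 0) : ∃ a : NormalMon, a.mon = g := by
  have key (k : ℕ) (h : Even k) (g g' : RMon)
      (e : ∀ c, cobd c g' = if Even k then tau * c g else 0) : c g = 0 := by
    have := congrFun hc.2 g'
    rw [e, if_pos h] at this
    exact (mul_eq_zero.1 this).resolve_left Polynomial.X_ne_zero
  rcases g with k | ⟨i, k⟩ | ⟨j, k⟩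
  · obtain ⟨k, rfl | rfl⟩ := k.even_or_odd'
    · exact ⟨.W k, rfl⟩
    · exact absurd (key (2 * k) (even_two_mul k) _ (.Y 2 (2 * k)) fun _ => rfl) hg
  · obtain ⟨k, rfl | rfl⟩ := k.even_or_odd'
    · exact ⟨.X i k, rfl⟩
    · exact ⟨.A i k, rfl⟩
  · obtain ⟨k, rfl | rfl⟩ := k.even_or_odd'
    · exact ⟨.Y j k, rfl⟩
    · exact absurd (key (2 * k) (even_two_mul k) _ (.Y (j + 3) (2 * k)) fun _ => rfl) hg

theorem IsCocycle.exists_isRepr {n : ℕ} {d : ℤ × ℤ} {c : RMon → M2} (hc : IsCocycle n d c) :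
    ∃ r, IsRepr n d r ∧ coch r = c := by
  classical
  let s := (monos n).preimage NormalMon.mon NormalMon.mon_injective.injOn
  refine ⟨∑ a ∈ s, c a.mon • a.poly, IsRepr.sum fun a ha => ?_, funext fun g => ?_⟩
  · rw [Finset.mem_preimage, mem_monos] at ha
    rw [MvPolynomial.smul_eq_C_mul]
    have h := (isRepr_C (d := d - a.mon.ideg) (p := c a.mon)
      (by rw [neg_sub]; exact (hc.1 a.mon).1)).mul a.isRepr_poly
    rwa [zero_add, sub_add_cancel, ha] at h
  · by_cases hg : c g = 0
    · rw [hg, coch_sum]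
      refine Finset.sum_eq_zero fun a _ => ?_
      rw [coch_smul, NormalMon.coch_poly]
      split_ifs with h
      · rw [← h, hg, zero_mul]
      · rw [mul_zero]
    · obtain ⟨a, rfl⟩ := hc.exists_mon_eq hg
      refine coch_sum_poly s (fun a => c a.mon) a ?_
      rw [Finset.mem_preimage, mem_monos]
      by_contra h
      exact hg ((hc.1 _).2 h)

/-! ### The isomorphism -/

/-- The class of a represented polynomial. -/
def extClass {n : ℕ} {d : ℤ × ℤ} {r : GenRing} (hr : IsRepr n d r) :
    GExt gradA1 unitModule unitModule (n, d) :=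
  theta n d (coch r) hr.isCocycle

theorem exists_extClass {n : ℕ} {d : ℤ × ℤ} (y : GExt gradA1 unitModule unitModule (n, d)) :
    ∃ (r : GenRing) (hr : IsRepr n d r), extClass hr = y := by
  obtain ⟨c, hc, rfl⟩ := exists_theta y
  obtain ⟨r, hr, rfl⟩ := hc.exists_isRepr
  exact ⟨r, hr, rfl⟩

theorem extClass_eq_zero_iff {n : ℕ} {d : ℤ × ℤ} {r : GenRing} (hr : IsRepr n d r) :
    extClass hr = 0 ↔ r ∈ relIdeal :=
  (theta_eq_zero_iff _).trans (mem_relIdeal_iff r).symm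

theorem theta_congr {n : ℕ} {d : ℤ × ℤ} {c c' : RMon → M2} (hc : IsCocycle n d c)
    (hc' : IsCocycle n d c') (h : c = c') : theta n d c hc = theta n d c' hc' := by
  subst h; rfl

theorem extClass_add {n : ℕ} {d : ℤ × ℤ} {r s : GenRing} (hr : IsRepr n d r)
    (hs : IsRepr n d s) : extClass (hr.add hs) = extClass hr + extClass hs :=
  (theta_congr _ _ (coch_add r s)).trans (theta_add hr.isCocycle hs.isCocycle)

theorem yonedaMul_extClass {n m : ℕ} {d e : ℤ × ℤ} {r s : GenRing} (hr : IsRepr n d r)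
    (hs : IsRepr m e s) (hrs : IsRepr (n + m : ℕ) (d + e) (r * s)) :
    yonedaMul gradA1 unitModule (extClass hr) (extClass hs) = extClass hrs := by
  have hr' := hr
  obtain ⟨F, h1, h2, h3⟩ := hr'
  exact yonedaMul_theta h2 h1 _ _ _ (fun z => by rw [← coch_one, h3, mul_one]) (h3 s)

theorem extClass_eq_iff {n : ℕ} {d : ℤ × ℤ} {r s : GenRing} (hr : IsRepr n d r)
    (hs : IsRepr n d s) : extClass hr = extClass hs ↔
      Ideal.Quotient.mk relIdeal r = Ideal.Quotient.mk relIdeal s := by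
  rw [Ideal.Quotient.eq, genRing_sub_eq_add, ← extClass_eq_zero_iff (hr.add hs), extClass_add hr hs]
  have h (y : GExt gradA1 unitModule unitModule (n, d)) : y + y = 0 := by
    obtain ⟨t, ht, rfl⟩ := exists_extClass y
    rw [← extClass_add, extClass_eq_zero_iff, ← genRing_sub_eq_add, sub_self]
    exact zero_mem _
  refine ⟨fun e => by rw [e, h], fun e => ?_⟩
  rw [← add_left_inj (extClass hs), e, h]

/-- A monomial of R together with a power of τ determines the degree, so represented polynomials of
different degrees have disjoint supports. -/
theorem coch_coeff_eq_zero {n : ℕ} {d : ℤ × ℤ} {r : GenRing} (hr : IsRepr n d r) {g : RMon}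
    {l : ℕ} (h : (coch r g).coeff l ≠ 0) : ((n : ℤ), d) = (g.hdeg, g.ideg - (0, (l : ℤ))) := by
  obtain ⟨h1, h2⟩ := hr.isCocycle.1 g
  refine Prod.ext ?_ ?_
  · by_contra hn
    rw [h2 fun h' => hn h'.symm] at h
    exact h (Polynomial.coeff_zero l)
  · rw [h1 l h, sub_sub_cancel]

/-- The inverse of the isomorphism, on the classes of given degrees. -/
def toQuotientAux (p : ℕ × ℤ × ℤ) : GExt gradA1 unitModule unitModule p →+ GenRing ⧸ relIdeal :=
  -- The representative is unique modulo the relations by `extClass_eq_iff`, so its residue class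
  -- depends additively on the Ext class.
  AddMonoidHom.mk' (fun y => Ideal.Quotient.mk relIdeal (exists_extClass (d := p.2) y).choose)
    fun x y => by
      obtain ⟨hx, ex⟩ := (exists_extClass (d := p.2) x).choose_spec
      obtain ⟨hy, ey⟩ := (exists_extClass (d := p.2) y).choose_spec
      obtain ⟨hxy, exy⟩ := (exists_extClass (d := p.2) (x + y)).choose_spec
      rw [← map_add, ← extClass_eq_iff hxy (hx.add hy), extClass_add hx hy, exy, ex, ey]

theorem toQuotientAux_extClass {n : ℕ} {d : ℤ × ℤ} {r : GenRing} (hr : IsRepr n d r) :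
    toQuotientAux (n, d) (extClass hr) = Ideal.Quotient.mk relIdeal r := by
  obtain ⟨h, e⟩ := (exists_extClass (extClass hr)).choose_spec
  exact (extClass_eq_iff h hr).1 e

/-- The inverse of the isomorphism. -/
def toQuotient : ExtA1 →+ GenRing ⧸ relIdeal := DirectSum.toAddMonoid toQuotientAux

theorem toQuotient_of {n : ℕ} {d : ℤ × ℤ} {r : GenRing} (hr : IsRepr n d r) :
    toQuotient (DirectSum.of _ (n, d) (extClass hr)) = Ideal.Quotient.mk relIdeal r :=
  (DirectSum.toAddMonoid_of _ _ _).trans (toQuotientAux_extClass hr)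

theorem toQuotient_mul (x y : ExtA1) : toQuotient (x * y) = toQuotient x * toQuotient y := by
  induction x using DirectSum.induction_on with
  | zero => rw [zero_mul, map_zero, zero_mul]
  | add x x' h h' => rw [add_mul, map_add, map_add, h, h', add_mul]
  | of p x =>
    induction y using DirectSum.induction_on with
    | zero => rw [mul_zero, map_zero, mul_zero]
    | add y y' h h' => rw [mul_add, map_add, map_add, h, h', mul_add]
    | of q y =>
      obtain ⟨n, d⟩ := p
      obtain ⟨m, e⟩ := q
      obtain ⟨r, hr, rfl⟩ := exists_extClass x
      obtain ⟨s, hs, rfl⟩ := exists_extClass y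
      have hrs : IsRepr (n + m : ℕ) (d + e) (r * s) := by push_cast; exact hr.mul hs
      have e1 : DirectSum.of (GExt gradA1 unitModule unitModule) (n, d) (extClass hr) *
          DirectSum.of _ (m, e) (extClass hs) = DirectSum.of _ (n + m, d + e) (extClass hrs) := by
        rw [← yonedaMul_extClass hr hs hrs]
        exact DirectSum.of_mul_of _ _
      rw [e1, toQuotient_of, toQuotient_of, toQuotient_of, map_mul]

/-- Being a coboundary is a condition on single coefficients, and the components have disjoint
supports. So if the sum of the representatives lies in the ideal, each of them does. -/
theorem toQuotient_injective : Function.Injective toQuotient := by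
  classical
  rw [injective_iff_map_eq_zero]
  intro z hz
  choose r hr h using fun p : ℕ × ℤ × ℤ => exists_extClass (d := p.2) (z p)
  have hz' : Ideal.Quotient.mk relIdeal (∑ p ∈ DFinsupp.support z, r p) = 0 := by
    rw [← hz]
    conv_rhs => rw [← DirectSum.sum_support_of z]
    rw [map_sum, map_sum]
    refine Finset.sum_congr rfl fun p _ => ?_
    rw [← h p]
    exact (toQuotient_of (hr p)).symm
  rw [Ideal.Quotient.eq_zero_iff_mem, mem_relIdeal_iff] at hz'
  refine DFinsupp.ext fun p => ?_
  by_cases hp : p ∈ DFinsupp.support z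
  swap
  · exact DFinsupp.notMem_support_iff.1 hp
  rw [← h p]
  refine (extClass_eq_zero_iff (hr p)).2 ((mem_relIdeal_iff _).2 fun g l hl => hz' g l ?_)
  rw [coch_sum, Polynomial.finsetSum_coeff, Finset.sum_eq_single p]
  · exact hl
  · intro q _ hq
    by_contra hl'
    refine hq ?_
    have e := (coch_coeff_eq_zero (hr q) hl').trans (coch_coeff_eq_zero (hr p) hl).symm
    rw [Prod.mk.injEq] at e
    exact Prod.ext (by exact_mod_cast e.1) e.2
  · exact fun h => absurd hp h

/-- A scalar need not be homogeneous, so it is split into its monomials; τ^k sits in internal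
bidegree `(0, -k)`. -/
theorem mk_C_mem_range (p : M2) :
    Ideal.Quotient.mk relIdeal (.C p) ∈ toQuotient.range := by
  rw [Polynomial.as_sum_support p, map_sum, map_sum]
  refine sum_mem fun k _ => ?_
  have h : Polynomial.monomial k (p.coeff k) ∈ gradM2 (-(0, -(k : ℤ))) := fun j hj => by
    rw [Polynomial.coeff_monomial] at hj
    have : k = j := by by_contra h; exact hj (if_neg h)
    simp [this]
  exact ⟨_, toQuotient_of (n := 0) (isRepr_C h)⟩

theorem toQuotient_surjective : Function.Surjective toQuotient := by
  intro x
  obtain ⟨r, rfl⟩ := Ideal.Quotient.mk_surjective x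
  change _ ∈ toQuotient.range
  induction r using MvPolynomial.induction_on with
  | C p => exact mk_C_mem_range p
  | add r s hr hs => rw [map_add]; exact add_mem hr hs
  | mul_X r i hr =>
    obtain ⟨y, hy⟩ := hr
    obtain ⟨y', hy'⟩ : Ideal.Quotient.mk relIdeal (.X i) ∈ toQuotient.range := by
      obtain ⟨h0, h1, h2, h3⟩ := isRepr_X
      obtain rfl | rfl | rfl | rfl : i = 0 ∨ i = 1 ∨ i = 2 ∨ i = 3 := by fin_cases i <;> simp
      · exact ⟨_, toQuotient_of (n := 1) h0⟩
      · exact ⟨_, toQuotient_of (n := 1) h1⟩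
      · exact ⟨_, toQuotient_of (n := 3) h2⟩
      · exact ⟨_, toQuotient_of (n := 4) h3⟩
    exact ⟨y * y', by rw [toQuotient_mul, hy, hy', map_mul]⟩

theorem SyzygyTower.cls_zero_eq_mk₀ {C : Type*} [Category C] [Abelian C] [HasExt C]
    (S : SyzygyTower C) {Y : C} (f : S.P 0 ⟶ Y) (hf : S.i 0 ≫ f = 0) (g : S.K 0 ⟶ Y)
    (h : f = S.π 0 ≫ g) : S.cls 0 f hf = Ext.mk₀ g := by
  have : S.desc 0 f hf = g := by rw [← cancel_epi (S.π 0), π_desc, h]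
  exact (Ext.mk₀_id_comp _).trans (congrArg Ext.mk₀ this)

theorem pairing_coch_C (p : M2) (z : Res) :
    pairing (coch (.C p)) z = p * pairing epsCochain z := by
  rw [← coch_one, ← mul_one (MvPolynomial.C p), funext (coch_C_mul p 1)]
  induction z using Finsupp.induction_linear with
  | zero => rw [map_zero, map_zero, mul_zero]
  | add y z hy hz => rw [map_add, map_add, hy, hz, mul_add]
  | single g y =>
    change pairing _ (gen g y) = p * pairing _ (gen g y)
    rw [pairing_gen, pairing_gen, map_smul, pairing_gen, map_one, one_mul, smul_eq_mul,
      mul_left_comm]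

theorem extClass_C {d : ℤ × ℤ} {p : M2} (hp : p ∈ gradM2 (-d)) :
    extClass (n := 0) (isRepr_C hp) = Ext.mk₀ (mulMap d p hp) := by
  have h : coHom 0 d (coch (.C p)) (isRepr_C hp).isCocycle.1 = resAug ≫ mulMap d p hp :=
    ObjectProperty.hom_ext _ (NatTrans.ext (funext fun _ => AddCommGrpCat.hom_ext
      (AddMonoidHom.ext fun z => Subtype.ext (pairing_coch_C p z.1))))
  exact resTower.cls_zero_eq_mk₀ _ _ _ h

/-- The isomorphism from `Ext`. -/
def extEquiv : ExtA1 ≃+* (GenRing ⧸ relIdeal) :=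
  { Equiv.ofBijective toQuotient ⟨toQuotient_injective, toQuotient_surjective⟩ with
    map_mul' := toQuotient_mul
    map_add' := map_add toQuotient }

theorem extEquiv_apply (x : ExtA1) : extEquiv x = toQuotient x := rfl

theorem extEquiv_symm_mk {n : ℕ} {d : ℤ × ℤ} {r : GenRing} (hr : IsRepr n d r) :
    extEquiv.symm (Ideal.Quotient.mk relIdeal r) = DirectSum.of _ (n, d) (extClass hr) := by
  rw [← toQuotient_of hr, ← extEquiv_apply, RingEquiv.symm_apply_apply]

end MotivicExt

end

open MotivicExt in
theorem mainTheorem8 :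
    ∃ Φ : (GenRing ⧸ relIdeal) ≃+* ExtA1,
      (∀ (d : ℤ × ℤ) (p : M2) (hp : p ∈ gradM2 (-d)),
        Φ (Ideal.Quotient.mk relIdeal (MvPolynomial.C p)) = scalar d p hp) ∧
      Φ (Ideal.Quotient.mk relIdeal (MvPolynomial.X 0)) ∈ adamsPart 0 1 0 ∧
      Φ (Ideal.Quotient.mk relIdeal (MvPolynomial.X 1)) ∈ adamsPart 1 1 1 ∧
      Φ (Ideal.Quotient.mk relIdeal (MvPolynomial.X 2)) ∈ adamsPart 4 3 2 ∧
      Φ (Ideal.Quotient.mk relIdeal (MvPolynomial.X 3)) ∈ adamsPart 8 4 4 := by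
  obtain ⟨h0, h1, h2, h3⟩ := isRepr_X
  -- The first internal degree is `s + n`: for the four generators 0 + 1, 1 + 1, 4 + 3 and 8 + 4.
  have key {s : ℤ} {n : ℕ} {w : ℤ} {r : GenRing} (hr : IsRepr n (s + n, w) r) :
      extEquiv.symm (Ideal.Quotient.mk relIdeal r) ∈ adamsPart s n w :=
    ⟨_, (extEquiv_symm_mk hr).symm⟩
  exact ⟨extEquiv.symm, fun d p hp => (extEquiv_symm_mk (n := 0) (isRepr_C hp)).trans
      (congrArg (DirectSum.of _ (0, d)) (extClass_C hp)),
    key (s := 0) (n := 1) h0, key (s := 1) (n := 1) h1, key (s := 4) (n := 3) h2,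
    key (s := 8) (n := 4) h3⟩
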